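/- **Setting.** Let $r,s\ge 0$, $d=r+s$, $\mathbb{R}^d=\mathbb{R}^r\times\mathbb{R}^{s}$. Let $R$ be a $d\times d$ integer matrix, $S=R^T$, and let $B,L\subset\mathbb{Z}^d$ be finite. Call $(R,B,L)$ a *Hadamard triple* if all complex eigenvalues of $R$ have modulus $>1$, $0\in B$, $0\in L$, $\#L=\#B=:N$, and the matrix $\frac1{\sqrt N}\left(e^{2\pi i R^{-1}b\cdot l}\right)_{b\in B,\,l\in L}$ is unitary. Put $\tau_b(x)=R^{-1}(x+b)$, $\sigma_l(x)=S^{-1}(x+l)$, $W_B(x)=\left|\frac1N\sum_{b\in B}e^{2\pi i b\cdot x}\right|^2$. Let $\mu=\mu_{R,B}$ be the unique probability measure on $\mathbb{R}^d$ with $\int f\,d\mu=\frac1N\sum_{b\in B}\int f\circ\tau_b\,d\mu$ for all continuous $f$, and let $\hat\mu(x)=\int e^{2\pi i t\cdot x}\,d\mu(t)$. A set $\Lambda$ is a *spectrum* of a probability measure $\nu$ if $\{e^{2\pi i\lambda\cdot x}\}_{\lambda\in\Lambda}$ is an orthonormal basis of $L^2(\nu)$. The *orbit* of $x$ is the closure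 of the set of all points $\sigma_{\omega_n}\cdots\sigma_{\omega_1}x$, $n\ge1$, where $(\omega_k)_{k\ge1}$ runs over the sequences in $L$ with $W_B(\sigma_{\omega_k}\cdots\sigma_{\omega_1}x)\ne0$ for all $k\ge 1$. A closed set $F\subset\mathbb{R}^d$ is *invariant* if it contains the orbits of all its points. For $x\in\mathbb{R}^d$ let $P_x$ be the unique probability measure on $L^{\mathbb{N}}$ with $P_x(\omega_1=l_1,\dots,\omega_n=l_n)=\prod_{k=1}^nW_B(\sigma_{l_k}\cdots\sigma_{l_1}x)$ for all $n$ and all $l_1,\dots,l_n\in L$, and let $N(F)=\{\omega\in L^{\mathbb N}:\lim_n d(\sigma_{\omega_n}\cdots\sigma_{\omega_1}x,F)=0\}$ (independent of $x$). A closed invariant set $F$ is *spectral with spectrum* $\Lambda\subset\mathbb{R}^d$ if $P_x(N(F))=\sum_{\lambda\in\Lambda}|\hat\mu(x+\lambda)|^2$ for all $x\in\mathbb{R}^d$. Let $A_1$ be the upper left $r\times r$ block of $R$, $S_1=A_1^T$; let $\{r_1,\dots,r_{N_1}\}$ ($r_i$ distinct) be the projection of $B$ to $\mathbb{Z}^r$,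 $N_2(i)=\#\{\eta:(r_i,\eta)\in B\}$, and $L_1(0)=\{l_1\in\mathbb{Z}^r:(l_1,0)\in L\}$. Let $\mu_1$ be the measure $\mu_{A_1,\{r_i\}}$, let $X_1=\{\sum_{k\ge1}A_1^{-k}r_{i_k}\}$, $\tau_{r_i}(x)=A_1^{-1}(x+r_i)$ and $W_1(x)=\left|\frac1{N_1}\sum_{i=1}^{N_1}e^{2\pi i r_i\cdot x}\right|$, $x\in\mathbb{R}^r$. **Statement.** Let $(R,B,L)$ be a Hadamard triple and suppose that $\mathbb{R}^r\times\{0\}$ is an invariant set. Then $\mathbb{R}^r\times\{0\}$ is invariant under the matrix $S$, i.e. $S(\mathbb{R}^r\times\{0\})\subset\mathbb{R}^r\times\{0\}$. If, in addition, (a) $\mu_1$ has no overlap, i.e. $\mu_1(\tau_{r_i}(X_1)\cap\tau_{r_j}(X_1))=0$ for all $i\ne j$, (i) $\Lambda_1\subset\mathbb{R}^r$ is a spectrum of $\mu_1$, (ii) $S_1\Lambda_1+L_1(0)\supset\Lambda_1$, and every $\lambda_1\in\Lambda_1$ is an $S_1$-period of $W_1$, i.e. $W_1(x+S_1^n\lambda_1)=W_1(x)$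 for all $x\in\mathbb{R}^r$, $n\ge0$, then the numbers $N_2(i)$ are all equal to one number $N_2$ (and $N_1N_2=N$), $(A_1,\{r_1,\dots,r_{N_1}\},L_1(0))$ is a Hadamard triple, and $\mathbb{R}^r\times\{0\}$ is a spectral invariant set with spectrum $$\bigcup_{n\ge0}\left(L+SL+\dots+S^{n-1}L+S^n(\Lambda_1\times\{0\})\right).$$ -/

import Mathlib

open Matrix Filter Topology MeasureTheory

noncomputable section

namespace AffineIFS

variable {ι : Type} [Fintype ι] [DecidableEq ι]

/-- An integer matrix viewed as a real matrix. -/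
def realMat (R : Matrix ι ι ℤ) : Matrix ι ι ℝ := R.map (fun a => (a : ℝ))

/-- An integer vector viewed as a real vector. -/
def realVec (b : ι → ℤ) : ι → ℝ := fun i => (b i : ℝ)

/-- All complex eigenvalues of `R` have absolute value greater than one. -/
def IsExpanding (R : Matrix ι ι ℤ) : Prop :=
  ∀ z ∈ spectrum ℂ (R.map (fun a => (a : ℂ))), 1 < ‖z‖

/-- The exponential function `e_lam(x) = exp(2 π i lam · x)`. -/
def expo (lam x : ι → ℝ) : ℂ :=
  Complex.exp (2 * Real.pi * Complex.I * ((lam ⬝ᵥ x : ℝ) : ℂ))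

/-- The matrix `N^{-1/2} (exp(2 π i R⁻¹ b · l))`, with rows `b ∈ B`, columns `l ∈ L`, `N = #B`. -/
def hadamardMatrix (R : Matrix ι ι ℤ) (B L : Finset (ι → ℤ)) : Matrix ↥B ↥L ℂ :=
  Matrix.of fun b l =>
    (1 / (Real.sqrt (B.card : ℝ) : ℂ)) * expo ((realMat R)⁻¹ *ᵥ realVec b.1) (realVec l.1)

/-- Hadamard triples, together with the standing assumptions on `R` and `B`. -/
structure IsHadamardTriple (R : Matrix ι ι ℤ) (B L : Finset (ι → ℤ)) : Prop where
  expanding : IsExpanding R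
  zero_mem_B : (0 : ι → ℤ) ∈ B
  zero_mem_L : (0 : ι → ℤ) ∈ L
  card_eq : L.card = B.card
  unitary_left : (hadamardMatrix R B L)ᴴ * hadamardMatrix R B L = 1
  unitary_right : hadamardMatrix R B L * (hadamardMatrix R B L)ᴴ = 1

/-- The contraction `τ_b(x) = R⁻¹ (x + b)`. -/
def tau (R : Matrix ι ι ℤ) (b : ι → ℤ) (x : ι → ℝ) : ι → ℝ :=
  (realMat R)⁻¹ *ᵥ (x + realVec b)

/-- The dual contraction `σ_l(x) = S⁻¹ (x + l)`, where `S = Rᵀ`. -/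
def sigma (R : Matrix ι ι ℤ) (l : ι → ℤ) (x : ι → ℝ) : ι → ℝ :=
  (realMat Rᵀ)⁻¹ *ᵥ (x + realVec l)

/-- The attractor `{∑_{k ≥ 1} R^{-k} b_k : b_k ∈ B}` of the maps `τ_b`, `b ∈ B`. -/
def attractor (R : Matrix ι ι ℤ) (B : Finset (ι → ℤ)) : Set (ι → ℝ) :=
  {x | ∃ b : ℕ → ↥B, HasSum (fun k => ((realMat R)⁻¹ ^ (k + 1)) *ᵥ realVec (b k).1) x}

/-- `μ` is a probability measure with `∫ f dμ = (1/N) ∑_{b ∈ B} ∫ f ∘ τ_b dμ` for all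
continuous `f`. -/
structure IsInvariantMeasure (R : Matrix ι ι ℤ) (B : Finset (ι → ℤ))
    (μ : Measure (ι → ℝ)) : Prop where
  prob : IsProbabilityMeasure μ
  integral_eq : ∀ f : (ι → ℝ) → ℂ, Continuous f →
    ∫ x, f x ∂μ = (1 / (B.card : ℂ)) * ∑ b ∈ B, ∫ x, f (tau R b x) ∂μ

open Classical in
/-- The invariant measure of the maps `τ_b`, `b ∈ B`: the (unique) measure satisfying
`IsInvariantMeasure`; the value `0` is taken only if there is none. -/
def invariantMeasure (R : Matrix ι ι ℤ) (B : Finset (ι → ℤ)) : Measure (ι → ℝ) :=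
  if h : ∃ μ, IsInvariantMeasure R B μ then h.choose else 0

/-- The Fourier transform `x ↦ ∫ exp(2 π i t · x) dμ(t)`. -/
def fourier (μ : Measure (ι → ℝ)) (x : ι → ℝ) : ℂ := ∫ t, expo t x ∂μ

/-- `Lam` is a spectrum of the probability measure `μ`: the exponentials `e_lam`, `lam ∈ Lam`,
form an orthonormal basis of `L²(μ)`. -/
def IsSpectrum (μ : Measure (ι → ℝ)) (Lam : Set (ι → ℝ)) : Prop :=
  IsProbabilityMeasure μ ∧
  ∃ e : ↥Lam → Lp ℂ 2 μ, (∀ lam : ↥Lam, (e lam : (ι → ℝ) → ℂ) =ᵐ[μ] expo lam.1) ∧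
    Orthonormal ℂ e ∧ (Submodule.span ℂ (Set.range e)).topologicalClosure = ⊤

/-- The filter `(1/N) ∑_{b ∈ B} exp(2 π i b · x)`. -/
def mask (B : Finset (ι → ℤ)) (x : ι → ℝ) : ℂ :=
  (1 / (B.card : ℂ)) * ∑ b ∈ B, expo (realVec b) x

/-- The function `W_B(x) = |(1/N) ∑_{b ∈ B} exp(2 π i b · x)|²`. -/
def W (B : Finset (ι → ℤ)) (x : ι → ℝ) : ℝ := ‖mask B x‖ ^ 2

/-- `p` is an `S`-period of `f`: `f(x + Sⁿ p) = f(x)` for all `x` and all `n ≥ 0`. -/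
def IsPeriod (S : Matrix ι ι ℤ) (f : (ι → ℝ) → ℝ) (p : ι → ℝ) : Prop :=
  ∀ (n : ℕ) (x : ι → ℝ), f (x + (realMat S ^ n) *ᵥ p) = f x

/-- `path R ω x n = σ_{ω_n} ⋯ σ_{ω_1} x`, the letters of the word being `ω_{k+1} = ω k`. -/
def path (R : Matrix ι ι ℤ) {L : Finset (ι → ℤ)} (ω : ℕ → ↥L) (x : ι → ℝ) : ℕ → (ι → ℝ)
  | 0 => x
  | n + 1 => sigma R (ω n).1 (path R ω x n)

/-- The union of all trajectories of `x`. -/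
def trajectories (R : Matrix ι ι ℤ) (B L : Finset (ι → ℤ)) (x : ι → ℝ) : Set (ι → ℝ) :=
  {y | ∃ ω : ℕ → ↥L, (∀ n, 1 ≤ n → W B (path R ω x n) ≠ 0) ∧ ∃ n, 1 ≤ n ∧ y = path R ω x n}

/-- The orbit of `x`. -/
def orbit (R : Matrix ι ι ℤ) (B L : Finset (ι → ℤ)) (x : ι → ℝ) : Set (ι → ℝ) :=
  closure (trajectories R B L x)

/-- A closed set is invariant if it contains the orbits of all of its points. -/
def IsInvariantSet (R : Matrix ι ι ℤ) (B L : Finset (ι → ℤ)) (F : Set (ι → ℝ)) : Prop :=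
  IsClosed F ∧ ∀ x ∈ F, orbit R B L x ⊆ F

/-- `P` is a probability measure on the words `ω_1 ω_2 …` over `L` that gives the cylinder
`{ω_1 = w_1, …, ω_n = w_n}` the mass `∏_{k=1}^n W_B(σ_{w_k} ⋯ σ_{w_1} x)`. -/
structure IsPathMeasure (R : Matrix ι ι ℤ) (B L : Finset (ι → ℤ)) (x : ι → ℝ)
    (P : Measure (ℕ → ↥L)) : Prop where
  prob : IsProbabilityMeasure P
  cylinder : ∀ (n : ℕ) (w : ℕ → ↥L),
    P {ω | ∀ k < n, ω k = w k} =
      ENNReal.ofReal (∏ k ∈ Finset.range n, W B (path R w x (k + 1)))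

open Classical in
/-- The path measure `P_x`: the (unique) measure satisfying `IsPathMeasure`; the value `0` is
taken only if there is none. -/
def pathMeasure (R : Matrix ι ι ℤ) (B L : Finset (ι → ℤ)) (x : ι → ℝ) : Measure (ℕ → ↥L) :=
  if h : ∃ P, IsPathMeasure R B L x P then h.choose else 0

/-- `N(F)`: the words `ω` with `dist(σ_{ω_n} ⋯ σ_{ω_1} x, F) → 0`. For expanding `R` this does
not depend on the point `x` or on the choice of the norm. -/
def wordsTo (R : Matrix ι ι ℤ) (L : Finset (ι → ℤ)) (F : Set (ι → ℝ)) : Set (ℕ → ↥L) :=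
  {ω | ∀ x : ι → ℝ, Tendsto (fun n => Metric.infEDist (path R ω x n) F) atTop (𝓝 0)}

/-- `F` is a spectral invariant set with spectrum `Lam`: `F` is closed and invariant and
`P_x(N(F)) = ∑_{lam ∈ Lam} |μ̂(x + lam)|²` for all `x`. -/
def IsSpectralSet (R : Matrix ι ι ℤ) (B L : Finset (ι → ℤ)) (F Lam : Set (ι → ℝ)) : Prop :=
  IsInvariantSet R B L F ∧
  ∀ x : ι → ℝ, HasSum (fun lam : ↥Lam => ‖fourier (invariantMeasure R B) (x + lam.1)‖ ^ 2)
    (pathMeasure R B L x (wordsTo R L F)).toReal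

/-- The measure of the system `(R, B)` has no overlap. -/
def NoOverlap (R : Matrix ι ι ℤ) (B : Finset (ι → ℤ)) : Prop :=
  ∀ b ∈ B, ∀ b' ∈ B, b ≠ b' →
    invariantMeasure R B (tau R b '' attractor R B ∩ tau R b' '' attractor R B) = 0

end AffineIFS

namespace AffineIFS

/-! The splitting `ℝ^d = ℝ^r × ℝ^s`, `d = r + s`, with coordinates indexed by
`Fin r ⊕ Fin s`. -/

variable {r s : ℕ}

/-- The subspace `ℝ^r × {0}`. -/
def plane (r s : ℕ) : Set (Fin r ⊕ Fin s → ℝ) := {v | ∀ j : Fin s, v (Sum.inr j) = 0}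

/-- The projection `ℤ^r × ℤ^s → ℤ^r`. -/
def fstVec (b : Fin r ⊕ Fin s → ℤ) : Fin r → ℤ := fun i => b (Sum.inl i)

/-- `{r_1, …, r_{N_1}}`, the projection of `B` to the first `r` coordinates. -/
def projB (B : Finset (Fin r ⊕ Fin s → ℤ)) : Finset (Fin r → ℤ) := B.image fstVec

/-- The number `N_2` of points of `B` that lie over `a`. -/
def fibreCard (B : Finset (Fin r ⊕ Fin s → ℤ)) (a : Fin r → ℤ) : ℕ :=
  (B.filter fun b => fstVec b = a).card

/-- `L_1(0) = {l_1 : (l_1, 0) ∈ L}`. -/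
def sliceL (L : Finset (Fin r ⊕ Fin s → ℤ)) : Finset (Fin r → ℤ) :=
  (L.filter fun l => ∀ j : Fin s, l (Sum.inr j) = 0).image fstVec

/-- The upper left `r × r` block `A_1` of `R`; its transpose is the block `S_1` of `S = Rᵀ`. -/
def blockA (R : Matrix (Fin r ⊕ Fin s) (Fin r ⊕ Fin s) ℤ) : Matrix (Fin r) (Fin r) ℤ :=
  R.toBlocks₁₁

/-- The function `W_1(x) = |(1/N_1) ∑_i exp(2 π i r_i · x)|`. -/
def W₁ (B : Finset (Fin r ⊕ Fin s → ℤ)) (x : Fin r → ℝ) : ℝ := ‖mask (projB B) x‖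

/-- The set `⋃_{n ≥ 0} (L + S L + ⋯ + S^{n-1} L + S^n (Lam × {0}))`, where `S = Rᵀ`. -/
def spectrumSet (R : Matrix (Fin r ⊕ Fin s) (Fin r ⊕ Fin s) ℤ)
    (L : Finset (Fin r ⊕ Fin s → ℤ)) (Lam : Set (Fin r → ℝ)) : Set (Fin r ⊕ Fin s → ℝ) :=
  {v | ∃ (n : ℕ) (l : Fin n → ↥L), ∃ lam ∈ Lam,
    v = ∑ k : Fin n, (realMat Rᵀ ^ (k : ℕ)) *ᵥ realVec (l k).1
      + (realMat Rᵀ ^ n) *ᵥ Sum.elim lam (fun _ => 0)}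

end AffineIFS

end

set_option linter.unusedSectionVars false

noncomputable section

namespace AffineIFS

variable {ι : Type} [Fintype ι] [DecidableEq ι]

/-! Write `V` for the plane `ℝ^r × {0}`. Since `W_B` is continuous and `W_B(0) = 1`, every `x ∈ V`
has a nonzero multiple `tx` with `W_B(S⁻¹tx) ≠ 0`. The letter `0` then gives `S⁻¹V ⊆ V`, and
equality of dimensions gives `SV = V` (`IsInvariantSet.mulVec_mem`). So `R` is block lower
triangular.

From a point of `V`, letters outside `V` have weight zero, so the weights over `L₁(0)` alone sum to
one (`sum_W_incl`). This is Parseval's identity for the matrix `√(N₂(a)/N) exp(2πi A₁⁻¹a·l)`, whose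
columns are orthonormal because those of the original matrix are. Characters are linearly
independent, so Parseval holds on a total family and the matrix is unitary
(`blockMatrix_mul_conjTranspose`). Its rows have length one: `N₂(a) · #L₁(0) = N` for every `a`.

For the spectral claim let `h(x) = ∑_{λ ∈ Λ₁} |μ̂(x + (λ,0))|²`. The projection of `μ` is `μ₁`, so
`h(x)` is the squared norm of the conditional expectation of `e_{-x}` on the first coordinates;
hence `h ≤ 1`, and `h(x)` is at least `|μ̂|²` at the normal part of `x`
(`IsSpectrum.exists_hasSum_fourier_sq`). By the refinement equation for `μ̂` and periodicity, a
transfer operator turns a sum over frequencies `p` into a sum over `l + Sp` (`hasSum_transfer`). As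
`(l, λ) ↦ l + S₁λ` is a bijection of `L₁(0) × Λ₁` onto `Λ₁`, `h` is fixed by the operator `T` of the
letters in `V`. The lower bound squeezes `T^m 1` to `h` (`tendsto_transfer_planeLetters`), so `h(x)`
is the probability that all letters lie in `V`.

Applying the full transfer operator `n` times to `h` yields both the probability that the letters
lie in `V` from position `n` on and the sum over the `n`-th level of the spectrum. Letters are
integral, so `N(V)` consists of the words eventually in `V` (`IsLowerBlock.wordsTo_plane`), and `n →
∞` finishes the proof. -/

lemma realMat_transpose (R : Matrix ι ι ℤ) : realMat Rᵀ = (realMat R)ᵀ := rfl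

lemma realVec_zero : realVec (0 : ι → ℤ) = 0 := by
  ext i; simp [realVec]

lemma realVec_mulVec (M : Matrix ι ι ℤ) (a : ι → ℤ) :
    realVec (M *ᵥ a) = realMat M *ᵥ realVec a := by
  ext i; simp [realVec, realMat, mulVec, dotProduct]

/-! ### Exponentials -/

lemma expo_add_left (a b x : ι → ℝ) : expo (a + b) x = expo a x * expo b x := by
  simp only [expo, add_dotProduct, ← Complex.exp_add]
  congr 1; push_cast; ring

lemma expo_comm (a x : ι → ℝ) : expo a x = expo x a := by
  simp only [expo, dotProduct_comm]

lemma expo_add_right (a x y : ι → ℝ) : expo a (x + y) = expo a x * expo a y := by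
  rw [expo_comm, expo_add_left, expo_comm x, expo_comm y]

@[simp] lemma expo_zero_left (x : ι → ℝ) : expo 0 x = 1 := by simp [expo]

@[simp] lemma expo_zero_right (x : ι → ℝ) : expo x 0 = 1 := by simp [expo]

@[simp] lemma norm_expo (a x : ι → ℝ) : ‖expo a x‖ = 1 := by
  rw [expo, show (2 * Real.pi * Complex.I * ((a ⬝ᵥ x : ℝ) : ℂ))
    = ((2 * Real.pi * (a ⬝ᵥ x) : ℝ) : ℂ) * Complex.I by push_cast; ring]
  exact Complex.norm_exp_ofReal_mul_I _

lemma conj_expo (a x : ι → ℝ) : (starRingEnd ℂ) (expo a x) = expo (-a) x := by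
  simp only [expo, ← Complex.exp_conj, map_mul, Complex.conj_ofReal, Complex.conj_I, map_ofNat,
    neg_dotProduct, Complex.ofReal_neg]
  congr 1; ring

lemma expo_neg_right (a x : ι → ℝ) : expo a (-x) = expo (-a) x := by
  simp [expo]

lemma expo_neg_mul_self (a x : ι → ℝ) : expo (-a) x * expo a x = 1 := by
  rw [← expo_add_left]; simp

lemma expo_sub_left (a b x : ι → ℝ) : expo (a - b) x = expo a x * expo (-b) x := by
  rw [sub_eq_add_neg, expo_add_left]

lemma expo_mulVec (M : Matrix ι ι ℝ) (a x : ι → ℝ) : expo (M *ᵥ a) x = expo a (Mᵀ *ᵥ x) := by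
  simp only [expo]
  rw [dotProduct_comm, dotProduct_mulVec, ← mulVec_transpose, dotProduct_comm]

lemma expo_realVec (a b : ι → ℤ) : expo (realVec a) (realVec b) = 1 := by
  rw [expo, Complex.exp_eq_one_iff]
  exact ⟨a ⬝ᵥ b, by simp [realVec, dotProduct]; ring⟩

@[fun_prop]
lemma continuous_expo (a : ι → ℝ) : Continuous (expo a) := by
  unfold expo
  refine Complex.continuous_exp.comp (continuous_const.mul (Complex.continuous_ofReal.comp ?_))
  exact Continuous.dotProduct continuous_const continuous_id

/-! ### Expanding matrices -/

lemma isUnit_map_complex {R : Matrix ι ι ℤ} (hR : IsExpanding R) :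
    IsUnit (R.map (fun a => (a : ℂ))) := by
  by_contra h
  have := hR 0 (spectrum.zero_mem_iff ℂ |>.2 h)
  simp at this
  linarith

lemma det_ne_zero_of_isExpanding {R : Matrix ι ι ℤ} (hR : IsExpanding R) : R.det ≠ 0 := by
  have h := (Matrix.isUnit_iff_isUnit_det _).1 (isUnit_map_complex hR)
  intro h0
  have : (R.map (fun a => (a : ℂ))).det = (R.det : ℂ) := by
    rw [← Int.cast_det]
  rw [this, h0] at h
  simp at h

lemma isUnit_det_realMat {R : Matrix ι ι ℤ} (hR : IsExpanding R) : IsUnit (realMat R).det := by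
  have : (realMat R).det = (R.det : ℝ) := by
    rw [realMat, ← Int.cast_det]
  rw [this]
  exact isUnit_iff_ne_zero.2 (by exact_mod_cast det_ne_zero_of_isExpanding hR)

lemma isUnit_det_realMat_transpose {R : Matrix ι ι ℤ} (hR : IsExpanding R) :
    IsUnit (realMat Rᵀ).det := by
  rw [realMat_transpose, det_transpose]; exact isUnit_det_realMat hR

/-! ### Decay of the powers of the inverse of an expanding matrix. -/

section Power

attribute [local instance] Matrix.linftyOpNormedRing Matrix.linftyOpNormedAlgebra

lemma norm_entry_le_linftyOpNorm (M : Matrix ι ι ℂ) (i j : ι) : ‖M i j‖ ≤ ‖M‖ := by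
  have h1 : ‖M i j‖₊ ≤ ∑ j, ‖M i j‖₊ :=
    Finset.single_le_sum (f := fun j => ‖M i j‖₊) (fun _ _ => zero_le) (Finset.mem_univ j)
  have h2 : (∑ j, ‖M i j‖₊) ≤ ‖M‖₊ := by
    rw [Matrix.linfty_opNNNorm_def]
    exact Finset.le_sup (f := fun i => ∑ j, ‖M i j‖₊) (Finset.mem_univ i)
  exact_mod_cast h1.trans h2

/-- Gelfand's formula: for `ρ` between the spectral radius and one, eventually `‖aⁿ‖ ≤ ρⁿ`. -/
lemma summable_norm_pow_of_spectralRadius_lt_one {A : Type*} [NormedRing A] [NormedAlgebra ℂ A]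
    [CompleteSpace A] {a : A} (ha : spectralRadius ℂ a < 1) : Summable fun n : ℕ => ‖a ^ n‖ := by
  obtain ⟨ρ, hρ1, hρ2⟩ := ENNReal.lt_iff_exists_nnreal_btwn.1 ha
  have hρ : (ρ : ℝ) < 1 := by exact_mod_cast hρ2
  have h := (spectrum.pow_nnnorm_pow_one_div_tendsto_nhds_spectralRadius a).eventually_lt_const hρ1
  refine Summable.of_norm_bounded_eventually_nat (g := fun n => (ρ : ℝ) ^ n)
    (summable_geometric_of_lt_one ρ.2 hρ) ?_
  filter_upwards [h, eventually_gt_atTop 0] with n hn hn0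
  rw [norm_norm]
  have h1 : (‖a ^ n‖₊ : ENNReal) ≤ (ρ : ENNReal) ^ n := by
    have := ENNReal.rpow_le_rpow hn.le (Nat.cast_nonneg n : (0 : ℝ) ≤ n)
    rwa [← ENNReal.rpow_mul, one_div_mul_cancel (by positivity), ENNReal.rpow_one,
      ENNReal.rpow_natCast] at this
  exact_mod_cast h1

/-- The eigenvalues of the inverse are reciprocals of those of `R`, so its complex spectral radius
is below one; real entries are bounded by the complex operator norm. -/
lemma summable_abs_inv_pow {R : Matrix ι ι ℤ} (hR : IsExpanding R) (i j : ι) :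
    Summable fun n : ℕ => |((realMat R)⁻¹ ^ n) i j| := by
  have : Nonempty ι := ⟨i⟩
  obtain ⟨u, hu⟩ := isUnit_map_complex hR
  have hsp : spectralRadius ℂ ((u⁻¹ : (Matrix ι ι ℂ)ˣ) : Matrix ι ι ℂ) < (1 : NNReal) := by
    refine spectrum.spectralRadius_lt_of_forall_lt _ fun z hz => ?_
    have hz0 : z ≠ 0 := by
      rintro rfl
      exact (spectrum.zero_mem_iff ℂ).1 hz (u⁻¹).isUnit
    have h1 := (spectrum.inv_mem_iff (r := Units.mk0 z hz0) (a := u⁻¹)).1 (by simpa using hz)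
    rw [inv_inv, hu] at h1
    have h2 := hR _ h1
    simp only [Units.val_inv_eq_inv_val, Units.val_mk0, norm_inv] at h2
    have h3 : ‖z‖ < 1 := by
      by_contra h
      exact absurd (inv_le_one_of_one_le₀ (not_lt.1 h)) (not_le.2 h2)
    exact_mod_cast h3
  have hs := summable_norm_pow_of_spectralRadius_lt_one
    (show spectralRadius ℂ ((u⁻¹ : (Matrix ι ι ℂ)ˣ) : Matrix ι ι ℂ) < 1 from hsp)
  refine Summable.of_nonneg_of_le (fun _ => abs_nonneg _) (fun n => ?_) hs
  refine le_trans (le_of_eq ?_) (norm_entry_le_linftyOpNorm _ i j)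
  have hinv : ((u⁻¹ : (Matrix ι ι ℂ)ˣ) : Matrix ι ι ℂ) = ((realMat R)⁻¹).map Complex.ofRealHom := by
    apply Units.inv_eq_of_mul_eq_one_right
    rw [hu]
    have : R.map (fun a => (a : ℂ)) = (realMat R).map Complex.ofRealHom := by
      ext i j; simp [realMat]
    rw [this, ← Matrix.map_mul, mul_nonsing_inv _ (isUnit_det_realMat hR)]
    simp
  rw [hinv, ← RingHom.mapMatrix_apply, ← map_pow]
  simp

end Power

lemma tendsto_inv_pow {R : Matrix ι ι ℤ} (hR : IsExpanding R) :
    Tendsto (fun n : ℕ => (realMat R)⁻¹ ^ n) atTop (𝓝 0) := by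
  refine tendsto_pi_nhds.2 fun i => tendsto_pi_nhds.2 fun j => ?_
  exact (tendsto_zero_iff_abs_tendsto_zero _).2 (summable_abs_inv_pow hR i j).tendsto_atTop_zero

lemma realMat_transpose_inv (R : Matrix ι ι ℤ) : (realMat Rᵀ)⁻¹ = ((realMat R)⁻¹)ᵀ := by
  rw [realMat_transpose, transpose_nonsing_inv]

lemma tendsto_inv_transpose_pow_mulVec {R : Matrix ι ι ℤ} (hR : IsExpanding R) (x : ι → ℝ) :
    Tendsto (fun n : ℕ => ((realMat Rᵀ)⁻¹ ^ n) *ᵥ x) atTop (𝓝 0) := by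
  have h : Tendsto (fun n : ℕ => (((realMat R)⁻¹ ^ n)ᵀ) *ᵥ x) atTop (𝓝 ((0ᵀ : Matrix ι ι ℝ) *ᵥ x)) :=
    ((Continuous.matrix_mulVec (continuous_id.matrix_transpose) continuous_const).tendsto 0).comp
      (tendsto_inv_pow hR)
  simpa only [realMat_transpose_inv, transpose_pow, transpose_zero, zero_mulVec] using h

lemma mulVec_sigma {R : Matrix ι ι ℤ} (hR : IsExpanding R) (l : ι → ℤ) (x : ι → ℝ) :
    realMat Rᵀ *ᵥ sigma R l x = x + realVec l := by
  rw [sigma, mulVec_mulVec, mul_nonsing_inv _ (isUnit_det_realMat_transpose hR), one_mulVec]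

lemma inv_mulVec_mulVec {R : Matrix ι ι ℤ} (hR : IsExpanding R) (x : ι → ℝ) :
    (realMat Rᵀ)⁻¹ *ᵥ (realMat Rᵀ *ᵥ x) = x := by
  rw [mulVec_mulVec, nonsing_inv_mul _ (isUnit_det_realMat_transpose hR), one_mulVec]

lemma mulVec_inv_mulVec {R : Matrix ι ι ℤ} (hR : IsExpanding R) (x : ι → ℝ) :
    realMat Rᵀ *ᵥ ((realMat Rᵀ)⁻¹ *ᵥ x) = x := by
  rw [mulVec_mulVec, mul_nonsing_inv _ (isUnit_det_realMat_transpose hR), one_mulVec]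

/-! ### The mask -/

lemma mask_zero {B : Finset (ι → ℤ)} (hB : B.Nonempty) : mask B 0 = 1 := by
  have : (B.card : ℂ) ≠ 0 := by exact_mod_cast hB.card_pos.ne'
  simp [mask, this]

lemma W_nonneg (B : Finset (ι → ℤ)) (x : ι → ℝ) : 0 ≤ W B x := sq_nonneg _

lemma W_zero {B : Finset (ι → ℤ)} (hB : B.Nonempty) : W B 0 = 1 := by
  simp [W, mask_zero hB]

@[fun_prop]
lemma continuous_mask (B : Finset (ι → ℤ)) : Continuous (mask B) := by
  unfold mask; fun_prop

lemma continuous_W (B : Finset (ι → ℤ)) : Continuous (W B) := by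
  unfold W; fun_prop

/-- `p` is a common period of the characters `e_b`, `b ∈ B`. -/
def IsCharPeriod (B : Finset (ι → ℤ)) (p : ι → ℝ) : Prop := ∀ b ∈ B, expo (realVec b) p = 1

lemma IsCharPeriod.mask_add {B : Finset (ι → ℤ)} {p : ι → ℝ} (hp : IsCharPeriod B p)
    (x : ι → ℝ) : mask B (x + p) = mask B x := by
  unfold mask
  congr 1
  exact Finset.sum_congr rfl fun b hb => by rw [expo_add_right, hp b hb, mul_one]

lemma IsCharPeriod.W_add {B : Finset (ι → ℤ)} {p : ι → ℝ} (hp : IsCharPeriod B p)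
    (x : ι → ℝ) : W B (x + p) = W B x := by rw [W, hp.mask_add, W]

lemma IsCharPeriod.add {B : Finset (ι → ℤ)} {p q : ι → ℝ} (hp : IsCharPeriod B p)
    (hq : IsCharPeriod B q) : IsCharPeriod B (p + q) := fun b hb => by
  rw [expo_add_right, hp b hb, hq b hb, one_mul]

lemma IsCharPeriod.sub {B : Finset (ι → ℤ)} {p q : ι → ℝ} (hp : IsCharPeriod B p)
    (hq : IsCharPeriod B q) : IsCharPeriod B (p - q) := fun b hb => by
  rw [sub_eq_add_neg, expo_add_right, hp b hb, one_mul, expo_neg_right, ← conj_expo, hq b hb,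
    map_one]

lemma isCharPeriod_realVec (B : Finset (ι → ℤ)) (a : ι → ℤ) : IsCharPeriod B (realVec a) :=
  fun b _ => expo_realVec b a

/-- A point where the mask has modulus one is a common period of the characters. -/
lemma isCharPeriod_of_norm_mask_eq_one {B : Finset (ι → ℤ)} (h0 : (0 : ι → ℤ) ∈ B) {p : ι → ℝ}
    (hp : ‖mask B p‖ = 1) : IsCharPeriod B p := by
  have hN : (B.card : ℝ) ≠ 0 := by exact_mod_cast (Finset.card_pos.2 ⟨_, h0⟩).ne'
  have hsum : ∑ b ∈ B, expo (realVec b) p = B.card * mask B p := by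
    have : (B.card : ℂ) ≠ 0 := by exact_mod_cast hN
    rw [mask]; field_simp
  -- The mean squared distance of unit vectors from their average `m` is `1 - |m|²`, which vanishes
  -- here; all the vectors therefore coincide.
  have key : ∑ b ∈ B, ‖expo (realVec b) p - mask B p‖ ^ 2 = 0 := by
    have : ∀ b ∈ B, ‖expo (realVec b) p - mask B p‖ ^ 2
        = 2 - 2 * (expo (realVec b) p * (starRingEnd ℂ) (mask B p)).re := by
      intro b _
      rw [← Complex.normSq_eq_norm_sq, Complex.normSq_sub, Complex.normSq_eq_norm_sq,
        Complex.normSq_eq_norm_sq, hp, norm_expo]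
      ring
    rw [Finset.sum_congr rfl this, Finset.sum_sub_distrib, ← Finset.mul_sum, ← Complex.re_sum,
      ← Finset.sum_mul, hsum, mul_assoc, Complex.mul_conj, Complex.normSq_eq_norm_sq, hp]
    simp; ring
  have h1 : ∀ b ∈ B, expo (realVec b) p = mask B p := fun b hb => by
    have := (Finset.sum_eq_zero_iff_of_nonneg (fun _ _ => sq_nonneg _)).1 key b hb
    exact sub_eq_zero.1 (by simpa using this)
  intro b hb
  rw [h1 b hb, ← h1 0 h0, realVec_zero, expo_zero_left]

/-! ### Measures on infinite words with prescribed cylinder masses -/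

section Words

variable {A X : Type}

/-- The word `a ω_0 ω_1 ⋯`. -/
def consWord (a : A) (ω : ℕ → A) : ℕ → A := fun k => Nat.casesOn k a ω

@[simp] lemma consWord_zero (a : A) (ω : ℕ → A) : consWord a ω 0 = a := rfl

@[simp] lemma consWord_succ (a : A) (ω : ℕ → A) (k : ℕ) : consWord a ω (k + 1) = ω k := rfl

lemma measurable_consWord [MeasurableSpace A] (a : A) : Measurable (consWord a) := by
  refine measurable_pi_lambda _ fun k => ?_
  cases k with
  | zero => exact measurable_const
  | succ k => exact measurable_pi_apply k

/-- The product of the weights met when the states are moved along the first `n` letters of the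
word `w`. -/
def pathWeight (g : A → X → ℝ) (f : A → X → X) : ℕ → (ℕ → A) → X → ℝ
  | 0, _, _ => 1
  | n + 1, w, x => g (w 0) x * pathWeight g f n (fun k => w (k + 1)) (f (w 0) x)

/-- The total weight of the words of length `n` whose `k`-th letter lies in `K k`. -/
def boxWeight (g : A → X → ℝ) (f : A → X → X) : ℕ → (ℕ → Finset A) → X → ℝ
  | 0, _, _ => 1
  | n + 1, K, x => ∑ a ∈ K 0, g a x * boxWeight g f n (fun k => K (k + 1)) (f a x)

lemma pathWeight_nonneg {g : A → X → ℝ} (hg : ∀ a x, 0 ≤ g a x) (f : A → X → X) (n : ℕ)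
    (w : ℕ → A) (x : X) : 0 ≤ pathWeight g f n w x := by
  induction n generalizing w x with
  | zero => exact zero_le_one
  | succ n ih => exact mul_nonneg (hg _ _) (ih _ _)

/-- The extension of a finite word by a constant letter. -/
def extendWord (a₀ : A) {n : ℕ} (w : Fin n → A) : ℕ → A :=
  fun k => if h : k < n then w ⟨k, h⟩ else a₀

lemma extendWord_cons (a₀ a : A) {n : ℕ} (w : Fin n → A) :
    extendWord a₀ (Fin.cons a w : Fin (n + 1) → A) = consWord a (extendWord a₀ w) := by
  ext k
  cases k with
  | zero => simp [extendWord]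
  | succ k =>
    by_cases h : k < n
    · simp only [extendWord, consWord_succ, Nat.succ_lt_succ_iff, h, dite_true]
      exact Fin.cons_succ (α := fun _ => A) a w ⟨k, h⟩
    · simp [extendWord, h]

lemma sum_pathWeight_eq_boxWeight [DecidableEq A] (g : A → X → ℝ) (f : A → X → X) (a₀ : A) (n : ℕ)
    (K : ℕ → Finset A) (x : X) :
    ∑ w ∈ Fintype.piFinset (fun k : Fin n => K k), pathWeight g f n (extendWord a₀ w) x
      = boxWeight g f n K x := by
  induction n generalizing K x with
  | zero => simp [boxWeight, pathWeight]
  | succ n ih =>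
    simp only [boxWeight, ← ih, Finset.mul_sum]
    rw [← Finset.sum_product']
    symm
    refine Finset.sum_bij' (fun p _ => (Fin.cons p.1 p.2 : Fin (n + 1) → A))
      (fun w _ => (w 0, Fin.tail w)) ?_ ?_ ?_ ?_ ?_
    · rintro ⟨a, w⟩ h
      simp only [Finset.mem_product, Fintype.mem_piFinset] at h ⊢
      intro k
      cases k using Fin.cases with
      | zero => simpa using h.1
      | succ k => simpa using h.2 k
    · intro w h
      simp only [Finset.mem_product, Fintype.mem_piFinset] at h ⊢
      exact ⟨h 0, fun k => h k.succ⟩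
    · rintro ⟨a, w⟩ _
      simp
    · intro w _
      simp
    · rintro ⟨a, w⟩ _
      simp [extendWord_cons, pathWeight]

lemma measurableSet_cylinder [MeasurableSpace A] [MeasurableSingletonClass A] (n : ℕ)
    (w : ℕ → A) : MeasurableSet {ω : ℕ → A | ∀ k < n, ω k = w k} := by
  have : {ω : ℕ → A | ∀ k < n, ω k = w k} =
      ⋂ k ∈ Finset.range n, (fun ω : ℕ → A => ω k) ⁻¹' {w k} := by
    ext ω; simp
  rw [this]
  exact Finset.measurableSet_biInter _ fun k _ =>
    (measurableSet_singleton (w k)).preimage (measurable_pi_apply k)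

/-- A box is a finite disjoint union of cylinders, one for each finite word chosen from the `K k`.
-/
lemma measure_box [DecidableEq A] [Nonempty A] [MeasurableSpace A] [MeasurableSingletonClass A]
    {g : A → X → ℝ} (hg : ∀ a x, 0 ≤ g a x) (f : A → X → X) {x : X} {P : Measure (ℕ → A)}
    (hP : ∀ (n : ℕ) (w : ℕ → A),
      P {ω | ∀ k < n, ω k = w k} = ENNReal.ofReal (pathWeight g f n w x))
    (n : ℕ) (K : ℕ → Finset A) :
    P {ω | ∀ k < n, ω k ∈ K k} = ENNReal.ofReal (boxWeight g f n K x) := by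
  obtain ⟨a₀⟩ := ‹Nonempty A›
  have hset : {ω : ℕ → A | ∀ k < n, ω k ∈ K k} =
      ⋃ w ∈ Fintype.piFinset (fun k : Fin n => K k), {ω | ∀ k < n, ω k = extendWord a₀ w k} := by
    ext ω
    simp only [Set.mem_ofPred_eq, Set.mem_iUnion, exists_prop, Fintype.mem_piFinset]
    constructor
    · intro h
      exact ⟨fun k => ω k, fun k => h k k.2, fun k hk => by simp [extendWord, hk]⟩
    · rintro ⟨w, hw, h⟩ k hk
      rw [h k hk]
      simpa [extendWord, hk] using hw ⟨k, hk⟩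
  rw [hset, measure_biUnion_finset, ← sum_pathWeight_eq_boxWeight g f a₀,
    ENNReal.ofReal_sum_of_nonneg fun _ _ => pathWeight_nonneg hg f _ _ _]
  · exact Finset.sum_congr rfl fun w _ => hP n _
  · intro w _ w' _ hne
    refine Set.disjoint_left.2 fun ω h h' => hne ?_
    ext k
    have := (h k k.2).symm.trans (h' k k.2)
    simpa [extendWord] using this
  · exact fun w _ => measurableSet_cylinder n _

variable [Fintype A] [MeasurableSpace A]

/-- The law of the first `n` letters, continued by a constant word. -/
def finiteLaw (g : A → X → ℝ) (f : A → X → X) (a₀ : A) : ℕ → X → Measure (ℕ → A)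
  | 0, _ => Measure.dirac fun _ => a₀
  | n + 1, x => ∑ a, ENNReal.ofReal (g a x) • (finiteLaw g f a₀ n (f a x)).map (consWord a)

lemma isProbabilityMeasure_finiteLaw {g : A → X → ℝ} (hg : ∀ a x, 0 ≤ g a x)
    (hg1 : ∀ x, ∑ a, g a x = 1) (f : A → X → X) (a₀ : A) (n : ℕ) (x : X) :
    IsProbabilityMeasure (finiteLaw g f a₀ n x) := by
  induction n generalizing x with
  | zero => rw [finiteLaw]; infer_instance
  | succ n ih =>
    constructor
    simp only [finiteLaw, Measure.coe_finsetSum, Finset.sum_apply, Measure.smul_apply, smul_eq_mul]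
    rw [← ENNReal.ofReal_one, ← hg1 x, ENNReal.ofReal_sum_of_nonneg fun a _ => hg a x]
    refine Finset.sum_congr rfl fun a _ => ?_
    have := ih (f a x)
    have := Measure.isProbabilityMeasure_map (μ := finiteLaw g f a₀ n (f a x))
      (measurable_consWord a).aemeasurable
    rw [measure_univ, mul_one]

lemma finiteLaw_cylinder [MeasurableSingletonClass A] {g : A → X → ℝ} (hg : ∀ a x, 0 ≤ g a x)
    (hg1 : ∀ x, ∑ a, g a x = 1) (f : A → X → X) (a₀ : A) (m n : ℕ) (hmn : m ≤ n)
    (w : ℕ → A) (x : X) :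
    finiteLaw g f a₀ n x {ω | ∀ k < m, ω k = w k} = ENNReal.ofReal (pathWeight g f m w x) := by
  induction m generalizing n w x with
  | zero =>
    have := isProbabilityMeasure_finiteLaw hg hg1 f a₀ n x
    simp [pathWeight]
  | succ m ih =>
    obtain ⟨n, rfl⟩ : ∃ n', n = n' + 1 := ⟨n - 1, by omega⟩
    simp only [finiteLaw, Measure.coe_finsetSum, Finset.sum_apply, Measure.smul_apply, smul_eq_mul]
    rw [Finset.sum_eq_single (w 0)]
    · rw [Measure.map_apply (measurable_consWord _) (measurableSet_cylinder _ _), pathWeight,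
        ENNReal.ofReal_mul (hg _ _), ← ih n (by omega)]
      congr 2
      ext ω
      simp only [Set.mem_preimage, Set.mem_ofPred_eq]
      constructor
      · intro h k hk
        exact h (k + 1) (by omega)
      · intro h k hk
        cases k with
        | zero => rfl
        | succ k => exact h k (by omega)
    · intro a _ ha
      rw [Measure.map_apply (measurable_consWord _) (measurableSet_cylinder _ _)]
      have : consWord a ⁻¹' {ω | ∀ k < m + 1, ω k = w k} = ∅ := by
        ext ω
        simp only [Set.mem_preimage, Set.mem_ofPred_eq, Set.mem_empty_iff_false,
          iff_false]
        exact fun h => ha (h 0 (Nat.succ_pos m))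
      rw [this, measure_empty, mul_zero]
    · simp

/-- Word space is compact, so the finite laws have a cluster point among the probability measures.
Cylinders are clopen and their masses are eventually constant in `n`, hence pass to the limit. -/
lemma exists_measure_cylinder [Nonempty A] [TopologicalSpace A] [DiscreteTopology A]
    [BorelSpace A] {g : A → X → ℝ} (hg : ∀ a x, 0 ≤ g a x)
    (hg1 : ∀ x, ∑ a, g a x = 1) (f : A → X → X) (x : X) :
    ∃ P : Measure (ℕ → A), IsProbabilityMeasure P ∧ ∀ (n : ℕ) (w : ℕ → A),
      P {ω | ∀ k < n, ω k = w k} = ENNReal.ofReal (pathWeight g f n w x) := by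
  obtain ⟨a₀⟩ := ‹Nonempty A›
  let ν : ℕ → ProbabilityMeasure (ℕ → A) := fun n =>
    ⟨finiteLaw g f a₀ n x, isProbabilityMeasure_finiteLaw hg hg1 f a₀ n x⟩
  obtain ⟨P, hP⟩ := exists_clusterPt_of_compactSpace (map ν atTop)
  obtain ⟨U, hU, hUP⟩ := mapClusterPt_iff_ultrafilter.1 hP
  refine ⟨P, P.2, fun n w => ?_⟩
  have hclopen : IsClopen {ω : ℕ → A | ∀ k < n, ω k = w k} := by
    have : {ω : ℕ → A | ∀ k < n, ω k = w k} =
        ⋂ k ∈ Finset.range n, (fun ω : ℕ → A => ω k) ⁻¹' {w k} := by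
      ext ω; simp
    rw [this]
    exact isClopen_biInter_finset fun k _ => (isClopen_discrete _).preimage (continuous_apply k)
  have h1 := ProbabilityMeasure.tendsto_measure_of_null_frontier_of_tendsto' hUP
    (E := {ω : ℕ → A | ∀ k < n, ω k = w k}) (by simp [hclopen.frontier_eq])
  refine tendsto_nhds_unique h1 (tendsto_const_nhds.congr' ?_)
  filter_upwards [hU (Ici_mem_atTop n)] with m hm
  exact (finiteLaw_cylinder hg hg1 f a₀ n m hm w x).symm

end Words

/-! ### Quadrature mirror identity and the path measures -/

lemma expo_inv_mulVec (R : Matrix ι ι ℤ) (b x : ι → ℝ) :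
    expo ((realMat R)⁻¹ *ᵥ b) x = expo b ((realMat Rᵀ)⁻¹ *ᵥ x) := by
  rw [expo_mulVec, realMat_transpose_inv]

/-- Up to the factor `1/√N`, the numbers `mask B (σ_l x)` are the coordinates of the image of the
unimodular vector `a` under a unitary matrix, and `‖a‖² = N`. -/
lemma sum_W_sigma {R : Matrix ι ι ℤ} {B L : Finset (ι → ℤ)} (h : IsHadamardTriple R B L)
    (x : ι → ℝ) : ∑ l ∈ L, W B (sigma R l x) = 1 := by
  have hN : (0 : ℝ) < B.card := by exact_mod_cast Finset.card_pos.2 ⟨_, h.zero_mem_B⟩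
  set a : ↥B → ℂ := fun b => expo (realVec b.1) ((realMat Rᵀ)⁻¹ *ᵥ x) with ha
  have hs : (Real.sqrt B.card : ℂ) ≠ 0 := by
    exact_mod_cast (Real.sqrt_pos.2 hN).ne'
  have hss : (Real.sqrt B.card : ℂ) * Real.sqrt B.card = B.card := by
    rw [← Complex.ofReal_mul, Real.mul_self_sqrt hN.le]; simp
  have hmask : ∀ l : ↥L, mask B (sigma R l.1 x)
      = (1 / (Real.sqrt B.card : ℂ)) * (a ᵥ* hadamardMatrix R B L) l := by
    intro l
    simp only [mask, vecMul, dotProduct, hadamardMatrix, of_apply, ha]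
    rw [← Finset.sum_coe_sort B, Finset.mul_sum, Finset.mul_sum]
    refine Finset.sum_congr rfl fun b _ => ?_
    rw [expo_inv_mulVec, sigma, mulVec_add, expo_add_right, ← hss]
    field_simp
  have hC : ((∑ l ∈ L, W B (sigma R l x) : ℝ) : ℂ) = 1 := by
    rw [← Finset.sum_coe_sort L]
    have : ∀ l : ↥L, ((W B (sigma R l.1 x) : ℝ) : ℂ) = (1 / (B.card : ℂ)) *
        ((a ᵥ* hadamardMatrix R B L) l * star ((a ᵥ* hadamardMatrix R B L) l)) := by
      intro l
      rw [W, Complex.ofReal_pow, ← Complex.mul_conj', hmask, map_mul, ← hss]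
      simp only [map_div₀, map_one, Complex.conj_ofReal, Complex.star_def]
      field_simp
    push_cast
    rw [Finset.sum_congr rfl fun l _ => this l, ← Finset.mul_sum]
    have h2 : ∑ l, (a ᵥ* hadamardMatrix R B L) l * star ((a ᵥ* hadamardMatrix R B L) l)
        = (a ᵥ* hadamardMatrix R B L) ⬝ᵥ star (a ᵥ* hadamardMatrix R B L) := rfl
    rw [h2, star_vecMul, dotProduct_mulVec, vecMul_vecMul, h.unitary_right, vecMul_one]
    have h3 : a ⬝ᵥ star a = B.card := by
      simp only [dotProduct, Pi.star_apply, ha, Complex.star_def, Complex.mul_conj',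
        norm_expo]
      simp
    rw [h3]
    have : (B.card : ℂ) ≠ 0 := by exact_mod_cast hN.ne'
    field_simp
  exact_mod_cast hC

lemma path_succ' (R : Matrix ι ι ℤ) {L : Finset (ι → ℤ)} (ω : ℕ → ↥L) (x : ι → ℝ) (n : ℕ) :
    path R ω x (n + 1) = path R (fun k => ω (k + 1)) (sigma R (ω 0).1 x) n := by
  induction n with
  | zero => rfl
  | succ n ih => rw [path, ih, path]

lemma prod_W_path (R : Matrix ι ι ℤ) (B : Finset (ι → ℤ)) {L : Finset (ι → ℤ)} (ω : ℕ → ↥L)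
    (x : ι → ℝ) (n : ℕ) :
    ∏ k ∈ Finset.range n, W B (path R ω x (k + 1)) =
      pathWeight (fun (l : ↥L) x => W B (sigma R l.1 x)) (fun l x => sigma R l.1 x) n ω x := by
  induction n generalizing ω x with
  | zero => simp [pathWeight]
  | succ n ih =>
    rw [Finset.prod_range_succ', pathWeight, ← ih, mul_comm]
    congr 1
    exact Finset.prod_congr rfl fun k _ => by rw [path_succ' R ω x (k + 1)]

lemma isPathMeasure_pathMeasure {R : Matrix ι ι ℤ} {B L : Finset (ι → ℤ)}
    (h : IsHadamardTriple R B L) (x : ι → ℝ) :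
    IsPathMeasure R B L x (pathMeasure R B L x) := by
  have : Nonempty ↥L := ⟨⟨0, h.zero_mem_L⟩⟩
  have : BorelSpace ↥L := inferInstance
  obtain ⟨P, hP, hcyl⟩ := exists_measure_cylinder (A := ↥L) (X := ι → ℝ)
    (g := fun l x => W B (sigma R l.1 x)) (fun _ _ => W_nonneg _ _)
    (fun x => by rw [Finset.sum_coe_sort L (fun l => W B (sigma R l x))]; exact sum_W_sigma h x)
    (fun l x => sigma R l.1 x) x
  have hex : ∃ P, IsPathMeasure R B L x P :=
    ⟨P, hP, fun n w => by rw [hcyl, prod_W_path]⟩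
  rw [pathMeasure, dif_pos hex]
  exact hex.choose_spec

lemma pathMeasure_box {R : Matrix ι ι ℤ} {B L : Finset (ι → ℤ)}
    (h : IsHadamardTriple R B L) (x : ι → ℝ) (n : ℕ) (K : ℕ → Finset ↥L) :
    pathMeasure R B L x {ω | ∀ k < n, ω k ∈ K k} = ENNReal.ofReal
      (boxWeight (fun (l : ↥L) x => W B (sigma R l.1 x)) (fun l x => sigma R l.1 x) n K x) := by
  have : Nonempty ↥L := ⟨⟨0, h.zero_mem_L⟩⟩
  refine measure_box (fun _ _ => W_nonneg _ _) _ (fun n w => ?_) n K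
  rw [(isPathMeasure_pathMeasure h x).cylinder, prod_W_path]

/-! ### The invariant measure -/

section InfiniteProduct

variable {A : Type} [MeasurableSpace A]

lemma measurable_uncurry_consWord :
    Measurable (fun p : A × (ℕ → A) => consWord p.1 p.2) := by
  refine measurable_pi_lambda _ fun k => ?_
  cases k with
  | zero => exact measurable_fst
  | succ k => exact (measurable_pi_apply k).comp measurable_snd

open Classical in
lemma map_consWord_prod_infinitePi (ρ : Measure A) [IsProbabilityMeasure ρ] :
    (ρ.prod (Measure.infinitePi fun _ : ℕ => ρ)).map (fun p => consWord p.1 p.2) =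
      Measure.infinitePi fun _ : ℕ => ρ := by
  refine Measure.eq_infinitePi _ fun s t ht => ?_
  -- Padding with `univ` replaces `s` by an initial segment containing `0`, so that the preimage
  -- under `consWord` is a product set.
  set t' : ℕ → Set A := fun i => if i ∈ s then t i else Set.univ with ht'
  have ht'm : ∀ i, MeasurableSet (t' i) := fun i => by
    simp only [ht']; split_ifs
    · exact ht i
    · exact MeasurableSet.univ
  obtain ⟨n, hn⟩ : ∃ n, s ⊆ Finset.range (n + 1) :=
    ⟨s.sup id, fun i hi => Finset.mem_range_succ_iff.2 (Finset.le_sup (f := id) hi)⟩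
  have h1 : (↑s : Set ℕ).pi t = (↑(Finset.range (n + 1)) : Set ℕ).pi t' := by
    ext ω
    simp only [Set.mem_pi, Finset.mem_coe, ht']
    constructor
    · intro h i _
      split_ifs with hi
      · exact h i hi
      · trivial
    · intro h i hi
      simpa [hi] using h i (hn hi)
  have h2 : ∏ i ∈ s, ρ (t i) = ∏ i ∈ Finset.range (n + 1), ρ (t' i) := by
    rw [← Finset.prod_subset hn fun i _ hi => by simp [ht', hi]]
    exact Finset.prod_congr rfl fun i hi => by simp [ht', hi]
  have h3 : (fun p : A × (ℕ → A) => consWord p.1 p.2) ⁻¹'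
      ((↑(Finset.range (n + 1)) : Set ℕ).pi t') =
      t' 0 ×ˢ (↑(Finset.range n) : Set ℕ).pi (fun i => t' (i + 1)) := by
    ext ⟨a, ω⟩
    simp only [Set.mem_preimage, Set.mem_pi, Finset.mem_coe, Finset.mem_range, Set.mem_prod]
    constructor
    · intro h
      exact ⟨h 0 (Nat.succ_pos n), fun i hi => h (i + 1) (by omega)⟩
    · rintro ⟨ha, h⟩ i hi
      cases i with
      | zero => exact ha
      | succ i => exact h i (by omega)
  have hm : MeasurableSet ((↑(Finset.range (n + 1)) : Set ℕ).pi t') :=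
    MeasurableSet.pi (Finset.countable_toSet _) fun i _ => ht'm i
  rw [h1, h2, Measure.map_apply measurable_uncurry_consWord hm, h3, Measure.prod_prod,
    Measure.infinitePi_pi _ fun i _ => ht'm (i + 1), Finset.prod_range_succ', mul_comm]

end InfiniteProduct

/-! ### The invariant measure as the image of a Bernoulli measure. -/

section Coding

variable {R : Matrix ι ι ℤ}

/-- The point `∑_{k ≥ 1} R^{-k} b_k` with the digits `b_{k+1} = ω k`. -/
def codingMap (R : Matrix ι ι ℤ) {B : Finset (ι → ℤ)} (ω : ℕ → ↥B) : ι → ℝ :=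
  ∑' k, ((realMat R)⁻¹ ^ (k + 1)) *ᵥ realVec (ω k).1

lemma exists_summable_bound (hR : IsExpanding R) (B : Finset (ι → ℤ)) :
    ∃ u : ℕ → ℝ, Summable u ∧ ∀ k, ∀ b ∈ B, ‖((realMat R)⁻¹ ^ (k + 1)) *ᵥ realVec b‖ ≤ u k := by
  obtain ⟨M, hM⟩ : ∃ M : ℝ, ∀ b ∈ B, ∀ j, |realVec b j| ≤ M := by
    refine ⟨∑ b ∈ B, ∑ j, |realVec b j|, fun b hb j => ?_⟩
    exact (Finset.single_le_sum (f := fun j => |realVec b j|) (fun _ _ => abs_nonneg _)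
      (Finset.mem_univ j)).trans (Finset.single_le_sum (f := fun b => ∑ j, |realVec b j|)
      (fun _ _ => Finset.sum_nonneg fun _ _ => abs_nonneg _) hb)
  refine ⟨fun k => ∑ i, ∑ j, |((realMat R)⁻¹ ^ (k + 1)) i j| * M, ?_, fun k b hb => ?_⟩
  · exact summable_sum fun i _ => summable_sum fun j _ =>
      ((summable_nat_add_iff 1).2 (summable_abs_inv_pow hR i j)).mul_right M
  · have hnn : ∀ i j, 0 ≤ |((realMat R)⁻¹ ^ (k + 1)) i j| * M := fun i j =>
      mul_nonneg (abs_nonneg _) ((abs_nonneg _).trans (hM b hb j))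
    refine (pi_norm_le_iff_of_nonneg (Finset.sum_nonneg fun i _ =>
      Finset.sum_nonneg fun j _ => hnn i j)).2 fun i => ?_
    refine le_trans ?_ (Finset.single_le_sum (f := fun i => ∑ j,
      |((realMat R)⁻¹ ^ (k + 1)) i j| * M) (fun i _ => Finset.sum_nonneg fun j _ => hnn i j)
      (Finset.mem_univ i))
    rw [mulVec, dotProduct, Real.norm_eq_abs]
    refine (Finset.abs_sum_le_sum_abs _ _).trans (Finset.sum_le_sum fun j _ => ?_)
    rw [abs_mul]
    exact mul_le_mul_of_nonneg_left (hM b hb j) (abs_nonneg _)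

lemma continuous_codingMap (hR : IsExpanding R) (B : Finset (ι → ℤ)) :
    Continuous (codingMap R (B := B)) := by
  obtain ⟨u, hu, hb⟩ := exists_summable_bound hR B
  refine continuous_tsum (fun k => ?_) hu fun k ω => hb k _ (ω k).2
  exact (continuous_of_discreteTopology
    (f := fun b : ↥B => ((realMat R)⁻¹ ^ (k + 1)) *ᵥ realVec b.1)).comp (continuous_apply k)

lemma codingMap_consWord (hR : IsExpanding R) {B : Finset (ι → ℤ)} (b : ↥B) (ω : ℕ → ↥B) :
    codingMap R (consWord b ω) = tau R b.1 (codingMap R ω) := by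
  obtain ⟨u, hu, hb⟩ := exists_summable_bound hR B
  have hs : ∀ ω : ℕ → ↥B, Summable fun k => ((realMat R)⁻¹ ^ (k + 1)) *ᵥ realVec (ω k).1 :=
    fun ω => Summable.of_norm_bounded hu fun k => hb k _ (ω k).2
  rw [codingMap, (hs _).tsum_eq_zero_add]
  have h1 : HasSum (fun k => (realMat R)⁻¹ *ᵥ (((realMat R)⁻¹ ^ (k + 1)) *ᵥ realVec (ω k).1))
      ((realMat R)⁻¹ *ᵥ codingMap R ω) :=
    (hs ω).hasSum.map (mulVecLin (realMat R)⁻¹)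
      (Continuous.matrix_mulVec continuous_const continuous_id)
  rw [tau, mulVec_add, add_comm]
  congr 1
  · rw [← h1.tsum_eq]
    refine tsum_congr fun k => ?_
    rw [mulVec_mulVec, ← pow_succ', consWord_succ]
  · simp

/-- Push forward the uniform Bernoulli measure by the coding map: prepending an independent uniform
digit preserves that measure and acts on points as `τ_b`. -/
lemma exists_isInvariantMeasure (hR : IsExpanding R) {B : Finset (ι → ℤ)} (hB : B.Nonempty) :
    ∃ μ, IsInvariantMeasure R B μ := by
  have : Nonempty ↥B := hB.to_subtype
  set ρ : Measure ↥B := (PMF.uniformOfFintype ↥B).toMeasure with hρ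
  set P : Measure (ℕ → ↥B) := Measure.infinitePi fun _ => ρ with hP
  have hc := continuous_codingMap hR B
  refine ⟨P.map (codingMap R), Measure.isProbabilityMeasure_map hc.measurable.aemeasurable,
    fun f hf => ?_⟩
  have hτ : ∀ b, Continuous (tau R b) := fun b =>
    Continuous.matrix_mulVec continuous_const (continuous_id.add continuous_const)
  rw [integral_map hc.measurable.aemeasurable hf.aestronglyMeasurable, ← Finset.sum_coe_sort B]
  have hint : Integrable (fun ω => f (codingMap R ω)) P := by
    obtain ⟨C, hC⟩ := isCompact_univ.exists_bound_of_continuousOn (hf.comp hc).continuousOn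
    exact Integrable.of_bound (hf.comp hc).aestronglyMeasurable C
      (Eventually.of_forall fun ω => hC ω trivial)
  have hmeas : Measurable (fun p : ↥B × (ℕ → ↥B) => consWord p.1 p.2) :=
    measurable_uncurry_consWord
  have hmap := map_consWord_prod_infinitePi ρ
  rw [← hP] at hmap
  have hint2 : Integrable (fun p : ↥B × (ℕ → ↥B) => f (codingMap R (consWord p.1 p.2)))
      (ρ.prod P) := by
    rw [← hmap] at hint
    exact hint.comp_measurable hmeas
  calc ∫ ω, f (codingMap R ω) ∂P
      = ∫ p, f (codingMap R (consWord p.1 p.2)) ∂(ρ.prod P) := by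
        conv_lhs => rw [← hmap]
        exact integral_map hmeas.aemeasurable (hf.comp hc).aestronglyMeasurable
    _ = ∫ b, ∫ ω, f (codingMap R (consWord b ω)) ∂P ∂ρ := integral_prod _ hint2
    _ = (1 / (B.card : ℂ)) * ∑ b : ↥B, ∫ x, f (tau R b.1 x) ∂(P.map (codingMap R)) := by
        rw [hρ, PMF.integral_eq_sum, Finset.mul_sum]
        refine Finset.sum_congr rfl fun b _ => ?_
        rw [integral_map (f := fun x => f (tau R b.1 x)) hc.measurable.aemeasurable
          (hf.comp (hτ b.1)).aestronglyMeasurable]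
        simp only [codingMap_consWord hR, PMF.uniformOfFintype_apply, Fintype.card_coe,
          ENNReal.toReal_inv, ENNReal.toReal_natCast, one_div, Complex.real_smul]
        push_cast
        rfl

lemma isInvariantMeasure_of_exists {B : Finset (ι → ℤ)} (h : ∃ μ, IsInvariantMeasure R B μ) :
    IsInvariantMeasure R B (invariantMeasure R B) := by
  rw [invariantMeasure, dif_pos h]
  exact h.choose_spec

lemma isInvariantMeasure_invariantMeasure (hR : IsExpanding R) {B : Finset (ι → ℤ)}
    (hB : B.Nonempty) : IsInvariantMeasure R B (invariantMeasure R B) :=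
  isInvariantMeasure_of_exists (exists_isInvariantMeasure hR hB)

end Coding

/-! ### Fourier transforms -/

lemma integrable_expo (μ : Measure (ι → ℝ)) [IsProbabilityMeasure μ] (x : ι → ℝ) :
    Integrable (fun t => expo t x) μ := by
  simp only [expo_comm _ x]
  exact Integrable.of_bound (continuous_expo x).aestronglyMeasurable 1
    (Eventually.of_forall fun t => (norm_expo _ _).le)

lemma fourier_zero (μ : Measure (ι → ℝ)) [IsProbabilityMeasure μ] : fourier μ 0 = 1 := by
  simp [fourier]

lemma norm_fourier_le_one (μ : Measure (ι → ℝ)) [IsProbabilityMeasure μ] (x : ι → ℝ) :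
    ‖fourier μ x‖ ≤ 1 := by
  refine (norm_integral_le_integral_norm _).trans ?_
  simp

lemma continuous_fourier (μ : Measure (ι → ℝ)) [IsProbabilityMeasure μ] :
    Continuous (fourier μ) := by
  refine continuous_of_dominated (bound := fun _ => 1) (fun x => (integrable_expo μ x).1)
    (fun x => Eventually.of_forall fun t => (norm_expo _ _).le) (integrable_const _)
    (Eventually.of_forall fun t => continuous_expo t)

/-- The refinement equation: invariance tested on an exponential. -/
lemma IsInvariantMeasure.fourier_eq {R : Matrix ι ι ℤ} {B : Finset (ι → ℤ)}
    {μ : Measure (ι → ℝ)} (hμ : IsInvariantMeasure R B μ) (x : ι → ℝ) :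
    fourier μ x = mask B ((realMat Rᵀ)⁻¹ *ᵥ x) * fourier μ ((realMat Rᵀ)⁻¹ *ᵥ x) := by
  rw [fourier]
  simp only [expo_comm _ x]
  rw [hμ.integral_eq _ (continuous_expo x), mask, mul_assoc, Finset.sum_mul]
  congr 1
  refine Finset.sum_congr rfl fun b _ => ?_
  rw [fourier, ← integral_const_mul]
  refine integral_congr_ae (Eventually.of_forall fun t => ?_)
  simp only
  rw [expo_comm x, tau, expo_inv_mulVec, expo_add_left, mul_comm]

lemma norm_mask_le_one (B : Finset (ι → ℤ)) (x : ι → ℝ) : ‖mask B x‖ ≤ 1 := by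
  rw [mask, norm_mul]
  have : ‖∑ b ∈ B, expo (realVec b) x‖ ≤ B.card := by
    refine (norm_sum_le _ _).trans ?_
    simp
  rcases Nat.eq_zero_or_pos B.card with h | h
  · simp [h]
  · have h' : (0 : ℝ) < B.card := by exact_mod_cast h
    rw [norm_div, norm_one, Complex.norm_natCast, one_div, inv_mul_le_iff₀ h', mul_one]
    exact this

/-- Iterating the refinement equation bounds the difference at `x` by the difference at `S⁻ⁿx → 0`,
where both transforms equal one. -/
lemma IsInvariantMeasure.fourier_unique {R : Matrix ι ι ℤ} (hR : IsExpanding R)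
    {B : Finset (ι → ℤ)} {μ ν : Measure (ι → ℝ)} (hμ : IsInvariantMeasure R B μ)
    (hν : IsInvariantMeasure R B ν) (x : ι → ℝ) : fourier μ x = fourier ν x := by
  have := hμ.prob
  have := hν.prob
  have hle : ∀ n : ℕ, ∀ x, ‖fourier μ x - fourier ν x‖ ≤
      ‖fourier μ ((realMat Rᵀ)⁻¹ ^ n *ᵥ x) - fourier ν ((realMat Rᵀ)⁻¹ ^ n *ᵥ x)‖ := by
    intro n
    induction n with
    | zero => simp
    | succ n ih =>
      intro x
      rw [hμ.fourier_eq, hν.fourier_eq, ← mul_sub, norm_mul]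
      refine (mul_le_of_le_one_left (norm_nonneg _) (norm_mask_le_one _ _)).trans ?_
      refine (ih _).trans (le_of_eq ?_)
      rw [mulVec_mulVec, ← pow_succ]
  have hlim : Tendsto (fun n : ℕ =>
      ‖fourier μ ((realMat Rᵀ)⁻¹ ^ n *ᵥ x) - fourier ν ((realMat Rᵀ)⁻¹ ^ n *ᵥ x)‖) atTop (𝓝 0) := by
    have h := (((continuous_fourier μ).sub (continuous_fourier ν)).norm.tendsto 0).comp
      (tendsto_inv_transpose_pow_mulVec hR x)
    simpa [fourier_zero, Function.comp_def] using h
  exact sub_eq_zero.1 (norm_le_zero_iff.1 (ge_of_tendsto' hlim fun n => hle n x))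

lemma ext_of_fourier {μ ν : Measure (ι → ℝ)} [IsProbabilityMeasure μ] [IsProbabilityMeasure ν]
    (h : ∀ x, fourier μ x = fourier ν x) : μ = ν := by
  refine Measure.ext_of_charFunDual ?_
  ext l
  have hl : ∀ t : ι → ℝ, Complex.exp (l t * Complex.I) =
      expo t (fun i => l (Pi.single i 1) / (2 * Real.pi)) := by
    intro t
    have hlt : l t = ∑ i, t i * l (Pi.single i 1) := by
      conv_lhs => rw [pi_eq_sum_univ' t]
      simp
    rw [hlt, expo, dotProduct]
    congr 1
    have : (Real.pi : ℂ) ≠ 0 := by exact_mod_cast Real.pi_ne_zero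
    push_cast
    rw [Finset.sum_mul, Finset.mul_sum]
    refine Finset.sum_congr rfl fun i _ => ?_
    field_simp
  simp only [charFunDual_apply, hl]
  exact h _

lemma IsInvariantMeasure.unique {R : Matrix ι ι ℤ} (hR : IsExpanding R)
    {B : Finset (ι → ℤ)} {μ ν : Measure (ι → ℝ)} (hμ : IsInvariantMeasure R B μ)
    (hν : IsInvariantMeasure R B ν) : μ = ν := by
  have := hμ.prob
  have := hν.prob
  exact ext_of_fourier (hμ.fourier_unique hR hν)

/-! ### The invariant plane -/

section Trajectory

variable {R : Matrix ι ι ℤ} {B L : Finset (ι → ℤ)}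

/-- Trajectories are infinite admissible words, but one admissible step always extends: the weights
at any point sum to one, so some next letter has nonzero weight. -/
lemma sigma_mem_trajectories (h : IsHadamardTriple R B L) {x : ι → ℝ} {l : ι → ℤ} (hl : l ∈ L)
    (hW : W B (sigma R l x) ≠ 0) : sigma R l x ∈ trajectories R B L x := by
  have hnext : ∀ y : ι → ℝ, ∃ l : ↥L, W B (sigma R l.1 y) ≠ 0 := by
    intro y
    by_contra! hy
    have := sum_W_sigma h y
    rw [Finset.sum_eq_zero fun l hl => hy ⟨l, hl⟩] at this
    exact zero_ne_one this
  choose nxt hnxt using hnext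
  let st : ℕ → (ι → ℝ) := fun n => Nat.rec (sigma R l x) (fun _ y => sigma R (nxt y).1 y) n
  let ω : ℕ → ↥L := consWord ⟨l, hl⟩ fun n => nxt (st n)
  have hpath : ∀ n, path R ω x (n + 1) = st n := by
    intro n
    induction n with
    | zero => rfl
    | succ n ih => rw [path, ih]; rfl
  refine ⟨ω, fun n hn => ?_, 1, le_rfl, (hpath 0).symm⟩
  obtain ⟨n, rfl⟩ : ∃ m, n = m + 1 := ⟨n - 1, by omega⟩
  rw [hpath]
  cases n with
  | zero => exact hW
  | succ n => exact hnxt _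

lemma IsInvariantSet.sigma_mem (h : IsHadamardTriple R B L) {F : Set (ι → ℝ)}
    (hF : IsInvariantSet R B L F) {x : ι → ℝ} (hx : x ∈ F) {l : ι → ℤ} (hl : l ∈ L)
    (hW : W B (sigma R l x) ≠ 0) : sigma R l x ∈ F :=
  hF.2 x hx (subset_closure (sigma_mem_trajectories h hl hW))

/-- An invariant linear subspace is mapped into itself by `S⁻¹`. -/
lemma IsInvariantSet.inv_mulVec_mem (h : IsHadamardTriple R B L) {V : Submodule ℝ (ι → ℝ)}
    (hV : IsInvariantSet R B L V) {x : ι → ℝ} (hx : x ∈ V) : (realMat Rᵀ)⁻¹ *ᵥ x ∈ V := by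
  have hc : Continuous fun t : ℝ => W B ((realMat Rᵀ)⁻¹ *ᵥ (t • x)) :=
    (continuous_W B).comp (Continuous.matrix_mulVec continuous_const
      (continuous_id.smul continuous_const))
  -- The weight at `t = 0` is one, so small nonzero multiples of `x` may be moved by the letter `0`;
  -- linearity then removes `t`.
  have hne : ∀ᶠ t in 𝓝 (0 : ℝ), W B ((realMat Rᵀ)⁻¹ *ᵥ (t • x)) ≠ 0 := by
    refine hc.continuousAt.eventually_ne ?_
    simp [W_zero ⟨_, h.zero_mem_B⟩]
  obtain ⟨t, ht, ht0⟩ := ((hne.filter_mono nhdsWithin_le_nhds).and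
    (self_mem_nhdsWithin : {(0 : ℝ)}ᶜ ∈ 𝓝[≠] (0 : ℝ))).exists
  have h1 : sigma R 0 (t • x) ∈ V := by
    refine hV.sigma_mem h (V.smul_mem t hx) h.zero_mem_L ?_
    simpa [sigma, realVec_zero] using ht
  rw [sigma, realVec_zero, add_zero, mulVec_smul] at h1
  exact (V.smul_mem_iff ht0).1 h1

/-- `S⁻¹` is injective and maps the finite-dimensional `V` into itself, hence onto itself. -/
lemma IsInvariantSet.mulVec_mem (h : IsHadamardTriple R B L) {V : Submodule ℝ (ι → ℝ)}
    (hV : IsInvariantSet R B L V) {x : ι → ℝ} (hx : x ∈ V) : realMat Rᵀ *ᵥ x ∈ V := by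
  have hinj : Function.Injective (mulVecLin (realMat Rᵀ)⁻¹) := fun y z hyz => by
    have := congrArg (realMat Rᵀ *ᵥ ·) hyz
    simpa only [mulVecLin_apply, mulVec_inv_mulVec h.expanding] using this
  have hle : V.map (mulVecLin (realMat Rᵀ)⁻¹) ≤ V := by
    rintro _ ⟨y, hy, rfl⟩
    exact hV.inv_mulVec_mem h hy
  have heq := Submodule.eq_of_le_of_finrank_eq hle
    (V.equivMapOfInjective _ hinj).finrank_eq.symm
  have hx' : x ∈ V.map (mulVecLin (realMat Rᵀ)⁻¹) := by rw [heq]; exact hx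
  obtain ⟨y, hy, rfl⟩ := hx'
  rwa [mulVecLin_apply, mulVec_inv_mulVec h.expanding]

end Trajectory

/-! ### Coordinates on the plane and block triangular matrices. -/

section Plane

variable {r s : ℕ}

/-- The plane `ℝ^r × {0}` as a linear subspace. -/
def planeSubmodule (r s : ℕ) : Submodule ℝ (Fin r ⊕ Fin s → ℝ) where
  carrier := plane r s
  add_mem' := fun {a b} ha hb j => by simp [ha j, hb j]
  zero_mem' := fun j => rfl
  smul_mem' := fun c x hx j => by simp [hx j]

/-- The inclusion `ℝ^r → ℝ^r × ℝ^s`. -/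
def incl (s : ℕ) (x : Fin r → ℝ) : Fin r ⊕ Fin s → ℝ := Sum.elim x fun _ => 0

/-- The projection `ℝ^r × ℝ^s → ℝ^r`. -/
def proj (v : Fin r ⊕ Fin s → ℝ) : Fin r → ℝ := fun i => v (Sum.inl i)

/-- The integral inclusion `ℤ^r → ℤ^r × ℤ^s`. -/
def inclInt (s : ℕ) (x : Fin r → ℤ) : Fin r ⊕ Fin s → ℤ := Sum.elim x fun _ => 0

lemma incl_mem_plane (x : Fin r → ℝ) : incl s x ∈ plane r s := fun _ => rfl

lemma incl_proj {v : Fin r ⊕ Fin s → ℝ} (hv : v ∈ plane r s) : incl s (proj v) = v := by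
  ext (i | j)
  · rfl
  · exact (hv j).symm

@[simp] lemma proj_incl (x : Fin r → ℝ) : proj (incl s x) = x := rfl

lemma incl_injective : Function.Injective (incl (r := r) s) := fun x y h => by
  simpa using congrArg proj h

lemma incl_add (x y : Fin r → ℝ) : incl s (x + y) = incl s x + incl s y := by
  ext (i | j) <;> simp [incl]

lemma incl_neg (x : Fin r → ℝ) : incl s (-x) = -incl s x := by
  ext (i | j) <;> simp [incl]

lemma proj_add (x y : Fin r ⊕ Fin s → ℝ) : proj (x + y) = proj x + proj y := rfl

lemma incl_realVec (l : Fin r → ℤ) : incl s (realVec l) = realVec (inclInt s l) := by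
  ext (i | j) <;> simp [incl, inclInt, realVec]

lemma proj_realVec (b : Fin r ⊕ Fin s → ℤ) : proj (realVec b) = realVec (fstVec b) := rfl

lemma continuous_proj : Continuous (proj (r := r) (s := s)) :=
  continuous_pi fun _ => continuous_apply _

lemma expo_incl (a : Fin r ⊕ Fin s → ℝ) (x : Fin r → ℝ) :
    expo a (incl s x) = expo (proj a) x := by
  simp [expo, dotProduct, incl, proj]

lemma mem_sliceL {L : Finset (Fin r ⊕ Fin s → ℤ)} {l : Fin r → ℤ} :
    l ∈ sliceL L ↔ inclInt s l ∈ L := by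
  simp only [sliceL, Finset.mem_image, Finset.mem_filter]
  constructor
  · rintro ⟨l', ⟨hl', h0⟩, rfl⟩
    convert hl'
    ext (i | j)
    · rfl
    · exact (h0 j).symm
  · intro h
    exact ⟨_, ⟨h, fun _ => rfl⟩, rfl⟩

/-- The plane is mapped into itself by `S`: the upper right block of `R` vanishes. -/
def IsLowerBlock (R : Matrix (Fin r ⊕ Fin s) (Fin r ⊕ Fin s) ℤ) : Prop :=
  R.toBlocks₁₂ = 0

variable {R : Matrix (Fin r ⊕ Fin s) (Fin r ⊕ Fin s) ℤ}

lemma isLowerBlock_of_mapsTo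
    (h : ∀ v ∈ plane r s, realMat Rᵀ *ᵥ v ∈ plane r s) : IsLowerBlock R := by
  ext i j
  have := h (incl s (Pi.single i 1)) (incl_mem_plane _) j
  have h2 : incl s (Pi.single i (1 : ℝ)) = Pi.single (Sum.inl i) 1 := by
    ext (k | k) <;> simp [incl, Pi.single_apply]
  rw [h2] at this
  simp only [mulVec_single_one, realMat] at this
  simpa [toBlocks₁₂] using this

lemma IsLowerBlock.apply (h : IsLowerBlock R) (i : Fin r) (j : Fin s) :
    R (Sum.inl i) (Sum.inr j) = 0 := congrFun (congrFun h i) j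

lemma IsLowerBlock.mulVec_incl (h : IsLowerBlock R) (x : Fin r → ℝ) :
    realMat Rᵀ *ᵥ incl s x = incl s (realMat (blockA R)ᵀ *ᵥ x) := by
  ext (i | j)
  · simp [mulVec, dotProduct, incl, realMat, blockA, toBlocks₁₁]
  · simp [mulVec, dotProduct, incl, realMat, h.apply]

lemma IsLowerBlock.pow_mulVec_incl (h : IsLowerBlock R) (n : ℕ) (x : Fin r → ℝ) :
    realMat Rᵀ ^ n *ᵥ incl s x = incl s (realMat (blockA R)ᵀ ^ n *ᵥ x) := by
  induction n with
  | zero => simp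
  | succ n ih => rw [pow_succ', ← mulVec_mulVec, ih, h.mulVec_incl, mulVec_mulVec, ← pow_succ']

lemma IsLowerBlock.proj_mulVec (h : IsLowerBlock R) (v : Fin r ⊕ Fin s → ℝ) :
    proj (realMat R *ᵥ v) = realMat (blockA R) *ᵥ proj v := by
  ext i
  simp [mulVec, dotProduct, proj, realMat, blockA, toBlocks₁₁, h.apply]

/-- The characteristic polynomial of a block triangular matrix is the product of those of its
diagonal blocks. -/
lemma IsLowerBlock.isExpanding (h : IsLowerBlock R) (hR : IsExpanding R) :
    IsExpanding (blockA R) := by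
  intro z hz
  refine hR z ?_
  rw [Matrix.mem_spectrum_iff_isRoot_charpoly] at hz ⊢
  have h1 : R.map (fun a => (a : ℂ)) = fromBlocks ((blockA R).map fun a => (a : ℂ)) 0
      (R.toBlocks₂₁.map fun a => (a : ℂ)) (R.toBlocks₂₂.map fun a => (a : ℂ)) := by
    ext (i | i) (j | j) <;> simp [blockA, toBlocks₁₁, toBlocks₂₁, toBlocks₂₂, h.apply]
  rw [h1, charpoly_fromBlocks_zero₁₂]
  exact Polynomial.root_mul_right_of_isRoot _ hz

lemma IsLowerBlock.inv_mulVec_incl (h : IsLowerBlock R) (hR : IsExpanding R) (x : Fin r → ℝ) :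
    (realMat Rᵀ)⁻¹ *ᵥ incl s x = incl s ((realMat (blockA R)ᵀ)⁻¹ *ᵥ x) := by
  conv_lhs => rw [← mulVec_inv_mulVec (h.isExpanding hR) x, ← h.mulVec_incl]
  rw [inv_mulVec_mulVec hR]

lemma IsLowerBlock.proj_tau (h : IsLowerBlock R) (hR : IsExpanding R)
    (b : Fin r ⊕ Fin s → ℤ) (x : Fin r ⊕ Fin s → ℝ) :
    proj (tau R b x) = tau (blockA R) (fstVec b) (proj x) := by
  have h1 : realMat R *ᵥ tau R b x = x + realVec b := by
    rw [tau, mulVec_mulVec, mul_nonsing_inv _ (isUnit_det_realMat hR), one_mulVec]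
  have h2 := h.proj_mulVec (tau R b x)
  rw [h1, proj_add, proj_realVec] at h2
  change _ = (realMat (blockA R))⁻¹ *ᵥ (proj x + realVec (fstVec b))
  rw [h2, mulVec_mulVec, nonsing_inv_mul _ (isUnit_det_realMat (h.isExpanding hR)),
    one_mulVec]

lemma IsLowerBlock.sigma_incl (h : IsLowerBlock R) (hR : IsExpanding R)
    (l : Fin r → ℤ) (x : Fin r → ℝ) :
    sigma R (inclInt s l) (incl s x) = incl s (sigma (blockA R) l x) := by
  rw [sigma, ← incl_realVec, ← incl_add, h.inv_mulVec_incl hR, sigma]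

end Plane

/-! ### The Hadamard triple of the upper left block -/

lemma expo_realVec_ext {a b : ι → ℤ} (h : ∀ y, expo (realVec a) y = expo (realVec b) y) :
    a = b := by
  by_contra hab
  obtain ⟨i, hi⟩ := Function.ne_iff.1 hab
  have hd : ((a i : ℝ) - b i) ≠ 0 := by
    exact_mod_cast sub_ne_zero.2 hi
  -- Chosen so that `(a - b) · y = 1/2`, where the two exponentials differ by the factor `-1`.
  set y : ι → ℝ := Pi.single i (1 / (2 * ((a i : ℝ) - b i))) with hy
  have h1 : expo (realVec a - realVec b) y = 1 := by
    rw [expo_sub_left, h, ← expo_add_left]; simp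
  have h2 : (realVec a - realVec b) ⬝ᵥ y = 1 / 2 := by
    rw [hy, dotProduct_single]
    simp only [Pi.sub_apply, realVec]
    field_simp
  rw [expo, h2, show (2 * Real.pi * Complex.I * ((1 / 2 : ℝ) : ℂ)) = Real.pi * Complex.I by
    push_cast; ring, Complex.exp_pi_mul_I] at h1
  norm_num at h1

/-- Dedekind's independence of distinct characters, applied on the group `ℝ^ι`. -/
lemma eq_zero_of_sum_expo_eq_zero {D : Finset (ι → ℤ)} {g : ↥D → ℂ}
    (h : ∀ y, ∑ a, g a * expo (realVec a.1) y = 0) : g = 0 := by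
  let χ : ↥D → (Multiplicative (ι → ℝ) →* ℂ) := fun a =>
    { toFun := fun y => expo (realVec a.1) y.toAdd
      map_one' := by simp
      map_mul' := fun y z => by simp [expo_add_right] }
  have hχ : Function.Injective χ := fun a b hab => by
    refine Subtype.ext (expo_realVec_ext fun y => ?_)
    exact DFunLike.congr_fun hab (Multiplicative.ofAdd y)
  have hli := (linearIndependent_monoidHom (Multiplicative (ι → ℝ)) ℂ).comp χ hχ
  rw [Fintype.linearIndependent_iff] at hli
  ext a
  refine hli g ?_ a
  ext y
  simpa [χ] using h y.toAdd

open scoped ComplexOrder in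
/-- An isometry whose range contains a total family, as seen from Parseval's identity,
is unitary. -/
lemma mul_conjTranspose_eq_one_of_parseval {m n Y : Type*} [Fintype m] [Fintype n]
    [DecidableEq m] [DecidableEq n] {M : Matrix m n ℂ} (hM : Mᴴ * M = 1) (v : Y → m → ℂ)
    (hpar : ∀ y, (star (v y) ᵥ* M) ⬝ᵥ (Mᴴ *ᵥ v y) = star (v y) ⬝ᵥ v y)
    (htot : ∀ q : m → ℂ, (∀ y, q ⬝ᵥ v y = 0) → q = 0) : M * Mᴴ = 1 := by
  set Q : Matrix m m ℂ := 1 - M * Mᴴ with hQ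
  have hQH : Qᴴ = Q := by simp [hQ]
  have hQQ : Q * Q = Q := by
    have : M * Mᴴ * (M * Mᴴ) = M * Mᴴ := by
      rw [Matrix.mul_assoc, ← Matrix.mul_assoc Mᴴ, hM, Matrix.one_mul]
    rw [hQ, Matrix.mul_sub, Matrix.mul_one, Matrix.sub_mul, Matrix.one_mul, this, sub_self,
      sub_zero]
  -- `Q` is the orthogonal projection onto the complement of the range of `M`, and Parseval says
  -- that `‖Q v_y‖² = ⟨v_y, Q v_y⟩ = 0`.
  have hQv : ∀ y, Q *ᵥ v y = 0 := by
    intro y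
    rw [← dotProduct_star_self_eq_zero, star_mulVec, hQH, ← dotProduct_mulVec, mulVec_mulVec, hQQ, hQ, sub_mulVec, one_mulVec,
      dotProduct_sub, ← mulVec_mulVec, dotProduct_mulVec, hpar, sub_self]
  have hQ0 : Q = 0 := by
    ext i j
    have := htot (Q i) fun y => congrFun (hQv y) i
    exact congrFun this j
  exact (sub_eq_zero.1 hQ0).symm

/-! ### Equal fibres and unitarity of the block. -/

section Block

variable {r s : ℕ} {R : Matrix (Fin r ⊕ Fin s) (Fin r ⊕ Fin s) ℤ}
  {B L : Finset (Fin r ⊕ Fin s → ℤ)}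

lemma inclInt_injective : Function.Injective (inclInt (r := r) s) := fun x y h => by
  ext i; exact congrFun h (Sum.inl i)

lemma plane_mulVec_mem (h : IsHadamardTriple R B L) (hF : IsInvariantSet R B L (plane r s)) :
    ∀ v ∈ plane r s, realMat Rᵀ *ᵥ v ∈ plane r s := fun _ hv =>
  IsInvariantSet.mulVec_mem (V := planeSubmodule r s) h hF hv

lemma isLowerBlock_of_isInvariantSet (h : IsHadamardTriple R B L)
    (hF : IsInvariantSet R B L (plane r s)) : IsLowerBlock R :=
  isLowerBlock_of_mapsTo (plane_mulVec_mem h hF)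

/-- A nonzero weight would put `σ_l x` in the plane by invariance; applying `S` puts `x + l`, hence
`l`, there too. -/
lemma W_sigma_eq_zero_of_notMem_plane (h : IsHadamardTriple R B L)
    (hF : IsInvariantSet R B L (plane r s)) {x : Fin r ⊕ Fin s → ℝ} (hx : x ∈ plane r s)
    {l : Fin r ⊕ Fin s → ℤ} (hl : l ∈ L) (hl' : realVec l ∉ plane r s) :
    W B (sigma R l x) = 0 := by
  by_contra hW
  have h1 := plane_mulVec_mem h hF _ (hF.sigma_mem h hx hl hW)
  rw [mulVec_sigma h.expanding] at h1
  have h2 : x + realVec l - x ∈ plane r s := (planeSubmodule r s).sub_mem h1 hx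
  exact hl' (by rwa [add_sub_cancel_left] at h2)

lemma eq_inclInt_of_mem_plane {l : Fin r ⊕ Fin s → ℤ} (hl : realVec l ∈ plane r s) :
    l = inclInt s (fstVec l) := by
  ext (i | j)
  · rfl
  · have := hl j
    simp only [realVec, Int.cast_eq_zero] at this
    simpa [inclInt] using this

lemma sum_W_incl (h : IsHadamardTriple R B L) (hF : IsInvariantSet R B L (plane r s))
    (x : Fin r → ℝ) :
    ∑ l ∈ sliceL L, W B (incl s (sigma (blockA R) l x)) = 1 := by
  have hb := isLowerBlock_of_isInvariantSet h hF
  rw [← sum_W_sigma h (incl s x)]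
  simp only [← hb.sigma_incl h.expanding]
  rw [← Finset.sum_image (f := fun l => W B (sigma R l (incl s x)))
    (fun _ _ _ _ h => inclInt_injective h)]
  refine Finset.sum_subset ?_ ?_
  · intro l hl
    obtain ⟨l', hl', rfl⟩ := Finset.mem_image.1 hl
    exact mem_sliceL.1 hl'
  · intro l hl hl'
    refine W_sigma_eq_zero_of_notMem_plane h hF (incl_mem_plane x) hl fun hp => hl' ?_
    rw [eq_inclInt_of_mem_plane hp] at hl ⊢
    exact Finset.mem_image_of_mem _ (mem_sliceL.2 hl)

lemma sum_comp_fstVec (B : Finset (Fin r ⊕ Fin s → ℤ)) (f : (Fin r → ℤ) → ℂ) :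
    ∑ b ∈ B, f (fstVec b) = ∑ a ∈ projB B, (fibreCard B a : ℂ) * f a := by
  rw [Finset.sum_comp]
  simp [projB, fibreCard]

lemma fibreCard_pos {a : Fin r → ℤ} (ha : a ∈ projB B) : 0 < fibreCard B a := by
  obtain ⟨b, hb, rfl⟩ := Finset.mem_image.1 ha
  exact Finset.card_pos.2 ⟨b, Finset.mem_filter.2 ⟨hb, rfl⟩⟩

lemma sum_fibreCard (B : Finset (Fin r ⊕ Fin s → ℤ)) :
    ∑ a ∈ projB B, fibreCard B a = B.card :=
  (Finset.card_eq_sum_card_image fstVec B).symm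

lemma mask_incl (B : Finset (Fin r ⊕ Fin s → ℤ)) (y : Fin r → ℝ) :
    mask B (incl s y) = ∑ a ∈ projB B, ((fibreCard B a / B.card : ℝ) : ℂ) * expo (realVec a) y := by
  simp only [mask, expo_incl, proj_realVec]
  rw [sum_comp_fstVec B fun a => expo (realVec a) y, Finset.mul_sum]
  refine Finset.sum_congr rfl fun a _ => ?_
  push_cast
  ring

lemma IsLowerBlock.expo_inv_inclInt (hb : IsLowerBlock R) (hR : IsExpanding R)
    (b : Fin r ⊕ Fin s → ℤ) (l : Fin r → ℤ) :
    expo ((realMat R)⁻¹ *ᵥ realVec b) (realVec (inclInt s l)) =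
      expo ((realMat (blockA R))⁻¹ *ᵥ realVec (fstVec b)) (realVec l) := by
  rw [expo_inv_mulVec, ← incl_realVec, hb.inv_mulVec_incl hR, expo_incl, proj_realVec,
    ← expo_inv_mulVec]

/-- The weighted matrix `(√(N₂(a)/N) exp(2 π i A₁⁻¹ a · l))`. -/
def blockMatrix (R : Matrix (Fin r ⊕ Fin s) (Fin r ⊕ Fin s) ℤ)
    (B L : Finset (Fin r ⊕ Fin s → ℤ)) : Matrix ↥(projB B) ↥(sliceL L) ℂ :=
  Matrix.of fun a l => (Real.sqrt (fibreCard B a.1 / B.card) : ℂ) *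
    expo ((realMat (blockA R))⁻¹ *ᵥ realVec a.1) (realVec l.1)

lemma sqrt_mul_sqrt_weight (B : Finset (Fin r ⊕ Fin s → ℤ)) (a : Fin r → ℤ) :
    (Real.sqrt (fibreCard B a / B.card) : ℂ) * (Real.sqrt (fibreCard B a / B.card) : ℂ) =
      ((fibreCard B a / B.card : ℝ) : ℂ) := by
  rw [← Complex.ofReal_mul, Real.mul_self_sqrt (by positivity)]

/-- For `l` in the plane, the column `l` of the original matrix depends on `b` only through its
first coordinates. Grouping by fibres turns multiplicities into the squared weights `N₂(a)/N`. -/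
lemma blockMatrix_conjTranspose_mul (h : IsHadamardTriple R B L) (hb : IsLowerBlock R) :
    (blockMatrix R B L)ᴴ * blockMatrix R B L = 1 := by
  have hN : (0 : ℝ) < B.card := by exact_mod_cast Finset.card_pos.2 ⟨_, h.zero_mem_B⟩
  have hss : (Real.sqrt B.card : ℂ) * Real.sqrt B.card = B.card := by
    rw [← Complex.ofReal_mul, Real.mul_self_sqrt hN.le]; simp
  ext l l'
  have h1 := congrFun (congrFun h.unitary_left ⟨_, mem_sliceL.1 l.2⟩) ⟨_, mem_sliceL.1 l'.2⟩
  have h2 : (1 : Matrix ↥L ↥L ℂ) ⟨_, mem_sliceL.1 l.2⟩ ⟨_, mem_sliceL.1 l'.2⟩ =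
      (1 : Matrix ↥(sliceL L) ↥(sliceL L) ℂ) l l' := by
    simp only [Matrix.one_apply, inclInt_injective.eq_iff, Subtype.ext_iff]
  rw [← h2, ← h1]
  simp only [mul_apply, conjTranspose_apply, blockMatrix, hadamardMatrix, of_apply,
    hb.expo_inv_inclInt h.expanding]
  rw [Finset.sum_coe_sort B (fun b => star (1 / (Real.sqrt B.card : ℂ) *
      expo ((realMat (blockA R))⁻¹ *ᵥ realVec (fstVec b)) (realVec l.1)) *
      (1 / (Real.sqrt B.card : ℂ) *
      expo ((realMat (blockA R))⁻¹ *ᵥ realVec (fstVec b)) (realVec l'.1))),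
    sum_comp_fstVec B (fun a => star (1 / (Real.sqrt B.card : ℂ) *
      expo ((realMat (blockA R))⁻¹ *ᵥ realVec a) (realVec l.1)) *
      (1 / (Real.sqrt B.card : ℂ) *
      expo ((realMat (blockA R))⁻¹ *ᵥ realVec a) (realVec l'.1))),
    ← Finset.sum_coe_sort (projB B)]
  refine Finset.sum_congr rfl fun a _ => ?_
  simp only [star_mul', Complex.star_def, map_div₀, map_one, Complex.conj_ofReal]
  have h3 := sqrt_mul_sqrt_weight B a.1
  have h4 : (1 / (Real.sqrt B.card : ℂ)) * (1 / (Real.sqrt B.card : ℂ)) = 1 / B.card := by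
    rw [div_mul_div_comm, one_mul, hss]
  push_cast at h3
  linear_combination ((starRingEnd ℂ) (expo ((realMat (blockA R))⁻¹ *ᵥ realVec a.1) (realVec l.1)) *
    expo ((realMat (blockA R))⁻¹ *ᵥ realVec a.1) (realVec l'.1)) * (h3 - fibreCard B a.1 * h4)

lemma blockMatrix_mul_conjTranspose (h : IsHadamardTriple R B L)
    (hF : IsInvariantSet R B L (plane r s)) :
    blockMatrix R B L * (blockMatrix R B L)ᴴ = 1 := by
  have hb := isLowerBlock_of_isInvariantSet h hF
  have hN : (0 : ℝ) < B.card := by exact_mod_cast Finset.card_pos.2 ⟨_, h.zero_mem_B⟩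
  refine mul_conjTranspose_eq_one_of_parseval (blockMatrix_conjTranspose_mul h hb)
    (fun (y : Fin r → ℝ) a => (Real.sqrt (fibreCard B a.1 / B.card) : ℂ) * expo (realVec a.1) y)
    (fun y => ?_) (fun q hq => ?_)
  -- The point `-S₁y` is chosen because `σ_l(-S₁y) = S₁⁻¹l - y`; Parseval for the vector indexed by
  -- `y` is then `sum_W_incl` at this point.
  · have h1 : ∀ l : ↥(sliceL L),
        ((star fun a : ↥(projB B) => (Real.sqrt (fibreCard B a.1 / B.card) : ℂ) *
          expo (realVec a.1) y) ᵥ* blockMatrix R B L) l =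
        mask B (incl s (sigma (blockA R) l.1 (-(realMat (blockA R)ᵀ *ᵥ y)))) := by
      intro l
      rw [mask_incl, ← Finset.sum_coe_sort (projB B)]
      simp only [vecMul, dotProduct, blockMatrix, of_apply]
      refine Finset.sum_congr rfl fun a _ => ?_
      simp only [Pi.star_apply, star_mul', Complex.star_def, Complex.conj_ofReal]
      rw [← sqrt_mul_sqrt_weight, sigma, mulVec_add, mulVec_neg,
        inv_mulVec_mulVec (hb.isExpanding h.expanding), expo_add_right, expo_neg_right, conj_expo,
        expo_inv_mulVec]
      ring
    have h2 : ∀ v : ↥(projB B) → ℂ, (star v ᵥ* blockMatrix R B L) ⬝ᵥ ((blockMatrix R B L)ᴴ *ᵥ v) =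
        ∑ l, (((‖(star v ᵥ* blockMatrix R B L) l‖ ^ 2 : ℝ)) : ℂ) := by
      intro v
      have : (blockMatrix R B L)ᴴ *ᵥ v = star (star v ᵥ* blockMatrix R B L) := by
        rw [star_vecMul, star_star]
      rw [this, dotProduct]
      refine Finset.sum_congr rfl fun l _ => ?_
      rw [Pi.star_apply, Complex.star_def, Complex.mul_conj']
      push_cast; rfl
    rw [h2]
    simp only [h1]
    rw [← Complex.ofReal_sum]
    have h3 := sum_W_incl h hF (-(realMat (blockA R)ᵀ *ᵥ y))
    rw [← Finset.sum_coe_sort (sliceL L)] at h3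
    simp only [W] at h3
    rw [h3]
    have h4 : ∀ a : ↥(projB B), star ((Real.sqrt (fibreCard B a.1 / B.card) : ℂ) *
        expo (realVec a.1) y) * ((Real.sqrt (fibreCard B a.1 / B.card) : ℂ) *
        expo (realVec a.1) y) = ((fibreCard B a.1 / B.card : ℝ) : ℂ) := by
      intro a
      simp only [star_mul', Complex.star_def, Complex.conj_ofReal]
      rw [conj_expo, ← sqrt_mul_sqrt_weight]
      linear_combination (Real.sqrt (fibreCard B a.1 / B.card) : ℂ) *
        (Real.sqrt (fibreCard B a.1 / B.card) : ℂ) * expo_neg_mul_self (realVec a.1) y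
    simp only [dotProduct, Pi.star_apply, h4]
    rw [← Complex.ofReal_sum, Finset.sum_coe_sort (projB B)
      (fun a => (fibreCard B a / B.card : ℝ)), ← Finset.sum_div, ← Nat.cast_sum, sum_fibreCard,
      div_self hN.ne']
  -- Totality: independence of characters kills the weighted coefficients, and the weights are
  -- nonzero because fibres over `projB B` are nonempty.
  · have h1 := eq_zero_of_sum_expo_eq_zero (D := projB B)
      (g := fun a => q a * (Real.sqrt (fibreCard B a.1 / B.card) : ℂ)) fun y => by
        rw [← hq y, dotProduct]
        exact Finset.sum_congr rfl fun a _ => mul_assoc _ _ _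
    ext a
    have h2 := congrFun h1 a
    have h3 : (Real.sqrt (fibreCard B a.1 / B.card) : ℂ) ≠ 0 := by
      have : (0 : ℝ) < fibreCard B a.1 := by exact_mod_cast fibreCard_pos a.2
      exact_mod_cast (Real.sqrt_pos.2 (div_pos this hN)).ne'
    exact (mul_eq_zero.1 h2).resolve_right h3

/-- The diagonal entry of `M Mᴴ = 1` at `a`: each of the `#L₁(0)` entries in that row has squared
modulus `N₂(a)/N`. -/
lemma fibreCard_mul_card_sliceL (h : IsHadamardTriple R B L)
    (hF : IsInvariantSet R B L (plane r s)) {a : Fin r → ℤ} (ha : a ∈ projB B) :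
    fibreCard B a * (sliceL L).card = B.card := by
  have hN : (B.card : ℂ) ≠ 0 := by
    exact_mod_cast (Finset.card_pos.2 ⟨_, h.zero_mem_B⟩).ne'
  have h1 := congrFun (congrFun (blockMatrix_mul_conjTranspose h hF) ⟨a, ha⟩) ⟨a, ha⟩
  rw [mul_apply, one_apply_eq] at h1
  have h2 : ∀ l, blockMatrix R B L ⟨a, ha⟩ l * (blockMatrix R B L)ᴴ l ⟨a, ha⟩ =
      ((fibreCard B a / B.card : ℝ) : ℂ) := by
    intro l
    simp only [conjTranspose_apply, blockMatrix, of_apply, star_mul', Complex.star_def,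
      Complex.conj_ofReal]
    rw [conj_expo, ← sqrt_mul_sqrt_weight]
    linear_combination (Real.sqrt (fibreCard B a / B.card) : ℂ) *
        (Real.sqrt (fibreCard B a / B.card) : ℂ) *
        expo_neg_mul_self ((realMat (blockA R))⁻¹ *ᵥ realVec a) (realVec l.1)
  simp only [h2, Finset.sum_const, Finset.card_univ, Fintype.card_coe, nsmul_eq_mul] at h1
  push_cast at h1
  field_simp at h1
  have : ((fibreCard B a * (sliceL L).card : ℕ) : ℂ) = (B.card : ℕ) := by
    push_cast; linear_combination h1
  exact_mod_cast this

lemma card_projB_eq (h : IsHadamardTriple R B L) (hF : IsInvariantSet R B L (plane r s)) :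
    (projB B).card = (sliceL L).card := by
  have h1 : ∑ a ∈ projB B, fibreCard B a * (sliceL L).card = (projB B).card * B.card := by
    rw [Finset.sum_congr rfl fun a ha => fibreCard_mul_card_sliceL h hF ha]
    simp
  rw [← Finset.sum_mul, sum_fibreCard, mul_comm] at h1
  exact (Nat.eq_of_mul_eq_mul_right (Finset.card_pos.2 ⟨_, h.zero_mem_B⟩) h1).symm

lemma zero_mem_projB (h : (0 : Fin r ⊕ Fin s → ℤ) ∈ B) : (0 : Fin r → ℤ) ∈ projB B :=
  Finset.mem_image.2 ⟨0, h, rfl⟩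

lemma exists_fibreCard_eq (h : IsHadamardTriple R B L)
    (hF : IsInvariantSet R B L (plane r s)) :
    ∃ N₂ : ℕ, (∀ a ∈ projB B, fibreCard B a = N₂) ∧ (projB B).card * N₂ = B.card := by
  have h0 := zero_mem_projB h.zero_mem_B
  have hK : 0 < (sliceL L).card := by
    rw [← card_projB_eq h hF]; exact Finset.card_pos.2 ⟨_, h0⟩
  refine ⟨fibreCard B (0 : Fin r → ℤ), fun a ha => ?_, ?_⟩
  · refine Nat.eq_of_mul_eq_mul_right hK ?_
    rw [fibreCard_mul_card_sliceL h hF ha, fibreCard_mul_card_sliceL h hF h0]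
  · rw [card_projB_eq h hF, mul_comm, fibreCard_mul_card_sliceL h hF h0]

lemma hadamardMatrix_block (h : IsHadamardTriple R B L)
    (hF : IsInvariantSet R B L (plane r s)) :
    hadamardMatrix (blockA R) (projB B) (sliceL L) = blockMatrix R B L := by
  ext a l
  have hN : (0 : ℝ) < B.card := by exact_mod_cast Finset.card_pos.2 ⟨_, h.zero_mem_B⟩
  have hK : (0 : ℝ) < (sliceL L).card := by
    rw [← card_projB_eq h hF]
    exact_mod_cast Finset.card_pos.2 ⟨_, zero_mem_projB h.zero_mem_B⟩
  have h1 : (fibreCard B a.1 : ℝ) * (sliceL L).card = B.card := by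
    exact_mod_cast fibreCard_mul_card_sliceL h hF a.2
  have h2 : (fibreCard B a.1 : ℝ) / B.card = ((sliceL L).card : ℝ)⁻¹ := by
    rw [← h1] at hN ⊢
    have := (pos_iff_pos_of_mul_pos hN).2 hK
    field_simp
  simp only [hadamardMatrix, blockMatrix, of_apply, h2, card_projB_eq h hF, Real.sqrt_inv]
  push_cast
  rw [one_div]

theorem isHadamardTriple_block (h : IsHadamardTriple R B L)
    (hF : IsInvariantSet R B L (plane r s)) :
    IsHadamardTriple (blockA R) (projB B) (sliceL L) where
  expanding := (isLowerBlock_of_isInvariantSet h hF).isExpanding h.expanding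
  zero_mem_B := zero_mem_projB h.zero_mem_B
  zero_mem_L := by
    rw [mem_sliceL]
    convert h.zero_mem_L
    ext (i | j) <;> rfl
  card_eq := (card_projB_eq h hF).symm
  unitary_left := by
    rw [hadamardMatrix_block h hF]
    exact blockMatrix_conjTranspose_mul h (isLowerBlock_of_isInvariantSet h hF)
  unitary_right := by
    rw [hadamardMatrix_block h hF]
    exact blockMatrix_mul_conjTranspose h hF

/-- The projection of the invariant measure of `(R, B)` is that of the upper left block. -/
lemma isInvariantMeasure_map_proj (h : IsHadamardTriple R B L)
    (hF : IsInvariantSet R B L (plane r s)) {μ : Measure (Fin r ⊕ Fin s → ℝ)}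
    (hμ : IsInvariantMeasure R B μ) :
    IsInvariantMeasure (blockA R) (projB B) (μ.map proj) := by
  have hb := isLowerBlock_of_isInvariantSet h hF
  have := hμ.prob
  have hN : (B.card : ℂ) ≠ 0 := by
    exact_mod_cast (Finset.card_pos.2 ⟨_, h.zero_mem_B⟩).ne'
  refine ⟨Measure.isProbabilityMeasure_map continuous_proj.measurable.aemeasurable,
    fun f hf => ?_⟩
  have hτ : ∀ a, Continuous (tau (blockA R) a) := fun a =>
    Continuous.matrix_mulVec continuous_const (continuous_id.add continuous_const)
  rw [integral_map continuous_proj.measurable.aemeasurable hf.aestronglyMeasurable,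
    hμ.integral_eq (fun x => f (proj x)) (hf.comp continuous_proj)]
  have h1 : ∀ b, ∫ x, f (proj (tau R b x)) ∂μ =
      ∫ x, f (tau (blockA R) (fstVec b) x) ∂(μ.map proj) := by
    intro b
    rw [integral_map (f := fun x => f (tau (blockA R) (fstVec b) x))
      continuous_proj.measurable.aemeasurable (hf.comp (hτ _)).aestronglyMeasurable]
    simp only [hb.proj_tau h.expanding]
  simp only [h1]
  rw [sum_comp_fstVec B (fun a => ∫ x, f (tau (blockA R) a x) ∂(μ.map proj)), Finset.mul_sum,
    Finset.mul_sum]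
  obtain ⟨N₂, hN₂, hcard⟩ := exists_fibreCard_eq h hF
  refine Finset.sum_congr rfl fun a ha => ?_
  rw [hN₂ a ha, ← hcard, ← mul_assoc]
  congr 1
  rw [← hcard] at hN
  push_cast at hN ⊢
  have h2 := left_ne_zero_of_mul hN
  have h3 := right_ne_zero_of_mul hN
  field_simp

end Block

/-! ### Exponentials in `L²` -/

section Spectrum

/-- The exponential `e_x` as an element of `L²(ν)`. -/
def expoLp (ν : Measure (ι → ℝ)) [IsProbabilityMeasure ν] (x : ι → ℝ) : Lp ℂ 2 ν :=
  (MemLp.of_bound (continuous_expo x).aestronglyMeasurable 1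
    (Eventually.of_forall fun t => (norm_expo x t).le)).toLp (expo x)

lemma coeFn_expoLp (ν : Measure (ι → ℝ)) [IsProbabilityMeasure ν] (x : ι → ℝ) :
    (expoLp ν x : (ι → ℝ) → ℂ) =ᵐ[ν] expo x := MemLp.coeFn_toLp _

lemma inner_expoLp (ν : Measure (ι → ℝ)) [IsProbabilityMeasure ν] (x y : ι → ℝ) :
    inner ℂ (expoLp ν x) (expoLp ν y) = fourier ν (y - x) := by
  rw [L2.inner_def, fourier]
  refine integral_congr_ae ?_
  filter_upwards [coeFn_expoLp ν x, coeFn_expoLp ν y] with t hx hy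
  rw [hx, hy, expo_comm t, expo_sub_left, ← conj_expo]
  simp

lemma norm_expoLp (ν : Measure (ι → ℝ)) [IsProbabilityMeasure ν] (x : ι → ℝ) :
    ‖expoLp ν x‖ = 1 := by
  have h : (inner ℂ (expoLp ν x) (expoLp ν x)).re = ‖expoLp ν x‖ ^ 2 :=
    inner_self_eq_norm_sq (𝕜 := ℂ) _
  rw [inner_expoLp, sub_self, fourier_zero, Complex.one_re] at h
  exact (pow_eq_one_iff_of_nonneg (norm_nonneg _) two_ne_zero).1 h.symm

lemma fourier_neg (ν : Measure (ι → ℝ)) (x : ι → ℝ) :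
    fourier ν (-x) = (starRingEnd ℂ) (fourier ν x) := by
  rw [fourier, fourier, ← integral_conj]
  refine integral_congr_ae (Eventually.of_forall fun t => ?_)
  simp only [expo_neg_right, conj_expo]

lemma norm_fourier_neg (ν : Measure (ι → ℝ)) (x : ι → ℝ) : ‖fourier ν (-x)‖ = ‖fourier ν x‖ := by
  rw [fourier_neg, RCLike.norm_conj]

lemma IsSpectrum.exists_hilbertBasis {ν : Measure (ι → ℝ)} [IsProbabilityMeasure ν]
    {Lam : Set (ι → ℝ)} (h : IsSpectrum ν Lam) :
    ∃ b : HilbertBasis ↥Lam ℂ (Lp ℂ 2 ν), ∀ lam, b lam = expoLp ν lam.1 := by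
  obtain ⟨-, e, he, ho, hd⟩ := h
  refine ⟨HilbertBasis.mk ho hd.ge, fun lam => ?_⟩
  rw [HilbertBasis.coe_mk]
  exact Lp.ext ((he lam).trans (coeFn_expoLp ν lam.1).symm)

lemma hasSum_norm_inner_sq {κ E : Type*} [NormedAddCommGroup E] [InnerProductSpace ℂ E]
    [CompleteSpace E] (b : HilbertBasis κ ℂ E) (v : E) :
    HasSum (fun i => ‖(inner ℂ (b i) v : ℂ)‖ ^ 2) (‖v‖ ^ 2) := by
  have h := (b.hasSum_inner_mul_inner v v).mapL Complex.reCLM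
  have h2 : ∀ i, (inner ℂ v (b i) : ℂ) * inner ℂ (b i) v =
      ((‖(inner ℂ (b i) v : ℂ)‖ ^ 2 : ℝ) : ℂ) := by
    intro i
    rw [← inner_conj_symm v (b i), Complex.conj_mul']
    push_cast; rfl
  have h3 : (inner ℂ v v).re = ‖v‖ ^ 2 := inner_self_eq_norm_sq (𝕜 := ℂ) v
  simpa only [h2, Complex.reCLM_apply, Complex.ofReal_re, h3] using h

/-- A frequency orthogonal to a spectrum does not exist. -/
lemma IsSpectrum.exists_fourier_ne_zero {ν : Measure (ι → ℝ)} [IsProbabilityMeasure ν]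
    {Lam : Set (ι → ℝ)} (h : IsSpectrum ν Lam) (x : ι → ℝ) :
    ∃ lam ∈ Lam, fourier ν (x - lam) ≠ 0 := by
  obtain ⟨b, hb⟩ := h.exists_hilbertBasis
  by_contra! hx
  have h1 := hasSum_norm_inner_sq b (expoLp ν x)
  have h2 : ∀ i, ‖(inner ℂ (b i) (expoLp ν x) : ℂ)‖ ^ 2 = 0 := fun i => by
    rw [hb, inner_expoLp, hx _ i.2]; simp
  simp only [h2, norm_expoLp] at h1
  have := h1.unique hasSum_zero
  norm_num at this

lemma IsSpectrum.fourier_sub_eq_zero {ν : Measure (ι → ℝ)} [IsProbabilityMeasure ν]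
    {Lam : Set (ι → ℝ)} (h : IsSpectrum ν Lam) {x y : ι → ℝ} (hx : x ∈ Lam) (hy : y ∈ Lam)
    (hxy : x ≠ y) : fourier ν (x - y) = 0 := by
  obtain ⟨b, hb⟩ := h.exists_hilbertBasis
  have := b.orthonormal.2 (i := ⟨y, hy⟩) (j := ⟨x, hx⟩) fun h => hxy (congrArg Subtype.val h).symm
  change (inner ℂ (b _) (b _) : ℂ) = 0 at this
  rwa [hb, hb, inner_expoLp] at this

variable {r s : ℕ}

/-- Parseval's identity for the conditional expectation of `e_{-x}` on the first coordinates. -/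
lemma IsSpectrum.exists_hasSum_fourier_sq {μ : Measure (Fin r ⊕ Fin s → ℝ)}
    [IsProbabilityMeasure μ] {Lam : Set (Fin r → ℝ)} (h : IsSpectrum (μ.map proj) Lam)
    (x : Fin r ⊕ Fin s → ℝ) :
    ∃ H : ℝ, HasSum (fun lam : ↥(incl s '' Lam) => ‖fourier μ (x + lam.1)‖ ^ 2) H ∧
      ‖fourier μ (x - incl s (proj x))‖ ^ 2 ≤ H ∧ H ≤ 1 := by
  have hmp : MeasurePreserving proj μ (μ.map proj) := ⟨continuous_proj.measurable, rfl⟩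
  have : IsProbabilityMeasure (μ.map proj) :=
    Measure.isProbabilityMeasure_map continuous_proj.measurable.aemeasurable
  obtain ⟨b, hb⟩ := h.exists_hilbertBasis
  -- `T` is composition with the projection; its adjoint is the conditional expectation on the first
  -- `r` coordinates.
  set T : Lp ℂ 2 (μ.map proj) →ₗᵢ[ℂ] Lp ℂ 2 μ := Lp.compMeasurePreservingₗᵢ ℂ proj hmp with hT
  have hTe : ∀ y, T (expoLp (μ.map proj) y) = expoLp μ (incl s y) := by
    intro y
    refine Lp.ext ((Lp.coeFn_compMeasurePreserving _ hmp).trans ?_)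
    refine (hmp.quasiMeasurePreserving.ae_eq_comp (coeFn_expoLp (μ.map proj) y)).trans ?_
    refine EventuallyEq.trans ?_ (coeFn_expoLp μ (incl s y)).symm
    refine Eventually.of_forall fun t => ?_
    rw [Function.comp_apply, expo_comm, ← expo_incl, expo_comm]
  set g := ContinuousLinearMap.adjoint T.toContinuousLinearMap (expoLp μ (-x)) with hg
  have hinner : ∀ y, ‖(inner ℂ (expoLp (μ.map proj) y) g : ℂ)‖ = ‖fourier μ (x + incl s y)‖ := by
    intro y
    rw [hg, ContinuousLinearMap.adjoint_inner_right, LinearIsometry.coe_toContinuousLinearMap,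
      hTe, inner_expoLp, ← norm_fourier_neg]
    congr 2
    abel
  have hg1 : ‖g‖ ≤ 1 := by
    refine (ContinuousLinearMap.le_opNorm _ _).trans ?_
    rw [norm_expoLp, mul_one, LinearIsometryEquiv.norm_map]
    exact T.norm_toContinuousLinearMap_le
  refine ⟨‖g‖ ^ 2, ?_, ?_, pow_le_one₀ (norm_nonneg _) hg1⟩
  · have h1 := hasSum_norm_inner_sq b g
    simp only [hb, hinner] at h1
    rw [← (Equiv.Set.image (incl s) Lam incl_injective).hasSum_iff]
    exact h1
  -- Cauchy–Schwarz against the unit vector `e_{-proj x}`, which need not belong to the basis; its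
  -- coefficient is `μ̂` at the normal part of `x`.
  · have h2 := norm_inner_le_norm (𝕜 := ℂ) (expoLp (μ.map proj) (-proj x)) g
    rw [norm_expoLp, one_mul, hinner, incl_neg, ← sub_eq_add_neg] at h2
    exact pow_le_pow_left₀ (norm_nonneg _) h2 2

end Spectrum

/-! ### The transfer operator -/

section Transfer

variable {R : Matrix ι ι ℤ} {B L : Finset (ι → ℤ)}

/-- The transfer operator `φ ↦ ∑_{l ∈ K} W_B(σ_l ·) φ(σ_l ·)`. -/
def transfer (R : Matrix ι ι ℤ) (B K : Finset (ι → ℤ)) (φ : (ι → ℝ) → ℝ) (x : ι → ℝ) : ℝ :=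
  ∑ l ∈ K, W B (sigma R l x) * φ (sigma R l x)

/-- Orthogonality of the columns `l` and `l'` of the Hadamard matrix. -/
lemma hadamard_mask_eq_zero (h : IsHadamardTriple R B L) {l l' : ι → ℤ} (hl : l ∈ L)
    (hl' : l' ∈ L) (hne : l ≠ l') :
    mask B ((realMat Rᵀ)⁻¹ *ᵥ (realVec l - realVec l')) = 0 := by
  have hN : (0 : ℝ) < B.card := by exact_mod_cast Finset.card_pos.2 ⟨_, h.zero_mem_B⟩
  have hss : (Real.sqrt B.card : ℂ) * Real.sqrt B.card = B.card := by
    rw [← Complex.ofReal_mul, Real.mul_self_sqrt hN.le]; simp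
  have hs : (Real.sqrt B.card : ℂ) ≠ 0 := by
    exact_mod_cast (Real.sqrt_pos.2 hN).ne'
  have h1 := congrFun (congrFun h.unitary_left ⟨l', hl'⟩) ⟨l, hl⟩
  rw [mul_apply, one_apply_ne fun h => hne (congrArg Subtype.val h).symm] at h1
  rw [← h1, mask, Finset.mul_sum, ← Finset.sum_coe_sort B]
  refine Finset.sum_congr rfl fun b _ => ?_
  simp only [conjTranspose_apply, hadamardMatrix, of_apply, star_mul', Complex.star_def, map_div₀,
    map_one, Complex.conj_ofReal]
  rw [conj_expo, ← expo_neg_right, ← expo_inv_mulVec, sub_eq_add_neg, expo_add_right, ← hss]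
  field_simp

/-- A collision makes `S⁻¹(l - l')` a difference of common periods, where the mask is one; for `l ≠
l'` the Hadamard condition makes it zero. -/
lemma injOn_add_mulVec (h : IsHadamardTriple R B L) {Γ : Set (ι → ℝ)}
    (hΓ : ∀ p ∈ Γ, IsCharPeriod B p) :
    Set.InjOn (fun p : (ι → ℤ) × (ι → ℝ) => realVec p.1 + realMat Rᵀ *ᵥ p.2)
      ((L : Set (ι → ℤ)) ×ˢ Γ) := by
  rintro ⟨l, p⟩ ⟨hl, hp⟩ ⟨l', p'⟩ ⟨hl', hp'⟩ heq
  simp only at heq hl hp hl' hp'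
  have h1 : (realMat Rᵀ)⁻¹ *ᵥ (realVec l - realVec l') = p' - p := by
    have h2 : realVec l - realVec l' = realMat Rᵀ *ᵥ (p' - p) := by
      rw [mulVec_sub, sub_eq_sub_iff_add_eq_add, heq, add_comm]
    rw [h2, inv_mulVec_mulVec h.expanding]
  have hll : l = l' := by
    by_contra hne
    have h3 := hadamard_mask_eq_zero h hl hl' hne
    have h4 := ((hΓ p' hp').sub (hΓ p hp)).mask_add 0
    rw [zero_add, mask_zero ⟨_, h.zero_mem_B⟩, ← h1, h3] at h4
    exact zero_ne_one h4
  subst hll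
  rw [sub_self, mulVec_zero] at h1
  rw [sub_eq_zero.1 h1.symm]

/-- The refinement equation at `x + l + Sp`, whose image under `S⁻¹` is `σ_l x + p`; the period `p`
drops out of `W_B`. -/
lemma W_mul_norm_fourier_sq (hR : IsExpanding R) {μ : Measure (ι → ℝ)}
    (hμ : IsInvariantMeasure R B μ) {p : ι → ℝ} (hp : IsCharPeriod B p) (l : ι → ℤ) (x : ι → ℝ) :
    W B (sigma R l x) * ‖fourier μ (sigma R l x + p)‖ ^ 2 =
      ‖fourier μ (x + (realVec l + realMat Rᵀ *ᵥ p))‖ ^ 2 := by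
  have h1 : (realMat Rᵀ)⁻¹ *ᵥ (x + (realVec l + realMat Rᵀ *ᵥ p)) = sigma R l x + p := by
    rw [← add_assoc, mulVec_add, inv_mulVec_mulVec hR, sigma]
  rw [hμ.fourier_eq (x + (realVec l + realMat Rᵀ *ᵥ p)), h1, norm_mul, mul_pow, ← hp.W_add, W]

/-- Summing the preceding identity over `K × Γ`: injectivity of `(l, p) ↦ l + Sp` ensures that no
frequency is counted twice. -/
lemma hasSum_transfer (hR : IsExpanding R) {μ : Measure (ι → ℝ)}
    (hμ : IsInvariantMeasure R B μ) {K : Finset (ι → ℤ)} {Γ Γ' : Set (ι → ℝ)}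
    (hΓ : ∀ p ∈ Γ, IsCharPeriod B p)
    (hbij : Set.BijOn (fun p : (ι → ℤ) × (ι → ℝ) => realVec p.1 + realMat Rᵀ *ᵥ p.2)
      ((K : Set (ι → ℤ)) ×ˢ Γ) Γ') {φ : (ι → ℝ) → ℝ}
    (hφ : ∀ x, HasSum (fun p : ↥Γ => ‖fourier μ (x + p.1)‖ ^ 2) (φ x)) (x : ι → ℝ) :
    HasSum (fun p : ↥Γ' => ‖fourier μ (x + p.1)‖ ^ 2) (transfer R B K φ x) := by
  let e : ↥K × ↥Γ ≃ ↥Γ' := (Equiv.Set.prod (K : Set (ι → ℤ)) Γ).symm.trans hbij.equiv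
  rw [← e.hasSum_iff]
  have he : ∀ q : ↥K × ↥Γ, (e q).1 = realVec q.1.1 + realMat Rᵀ *ᵥ q.2.1 := fun q => rfl
  have h1 : ∀ l : ↥K, HasSum (fun p : ↥Γ => ‖fourier μ (x + (e (l, p)).1)‖ ^ 2)
      (W B (sigma R l.1 x) * φ (sigma R l.1 x)) := by
    intro l
    simp only [he, ← W_mul_norm_fourier_sq hR hμ (hΓ _ (Subtype.coe_prop _))]
    exact (hφ _).mul_left _
  have hsum : Summable fun q : ↥K × ↥Γ => ‖fourier μ (x + (e q).1)‖ ^ 2 :=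
    (summable_prod_of_nonneg fun _ => sq_nonneg _).2
      ⟨fun l => (h1 l).summable, Summable.of_finite⟩
  have h2 := (hsum.hasSum.prod_fiberwise h1).unique (hasSum_fintype _)
  rw [transfer, ← Finset.sum_coe_sort K, ← h2]
  exact hsum.hasSum

lemma transfer_mono {K : Finset (ι → ℤ)} {φ ψ : (ι → ℝ) → ℝ} (h : ∀ x, φ x ≤ ψ x) (x : ι → ℝ) :
    transfer R B K φ x ≤ transfer R B K ψ x :=
  Finset.sum_le_sum fun _ _ => mul_le_mul_of_nonneg_left (h _) (W_nonneg _ _)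

lemma tendsto_transfer_iterate {K : Finset (ι → ℤ)} {φ : ℕ → (ι → ℝ) → ℝ} {ψ : (ι → ℝ) → ℝ}
    (h : ∀ x, Tendsto (fun m => φ m x) atTop (𝓝 (ψ x))) (n : ℕ) (x : ι → ℝ) :
    Tendsto (fun m => (transfer R B K)^[n] (φ m) x) atTop (𝓝 ((transfer R B K)^[n] ψ x)) := by
  induction n generalizing x with
  | zero => exact h x
  | succ n ih =>
    simp only [Function.iterate_succ_apply']
    exact tendsto_finsetSum _ fun l _ => (ih _).const_mul _

lemma boxWeight_const (K : Finset (ι → ℤ)) (hK : K ⊆ L) (m : ℕ) (x : ι → ℝ) :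
    boxWeight (fun (l : ↥L) x => W B (sigma R l.1 x)) (fun l x => sigma R l.1 x) m
      (fun _ => Finset.univ.filter fun l : ↥L => l.1 ∈ K) x = (transfer R B K)^[m] (fun _ => 1) x := by
  induction m generalizing x with
  | zero => rfl
  | succ m ih =>
    rw [boxWeight, Function.iterate_succ_apply', transfer]
    simp only [ih]
    rw [Finset.sum_filter, Finset.sum_coe_sort L (fun l => if l ∈ K then W B (sigma R l x) *
      (transfer R B K)^[m] (fun _ => 1) (sigma R l x) else 0), ← Finset.sum_filter,
      Finset.filter_mem_eq_inter, Finset.inter_eq_right.2 hK]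

/-- The first `n` letters are free and the next `m` are confined to `K`; the operator of the first
letter is outermost. -/
lemma boxWeight_eq_transfer (K : Finset (ι → ℤ)) (hK : K ⊆ L) (n m : ℕ) (x : ι → ℝ) :
    boxWeight (fun (l : ↥L) x => W B (sigma R l.1 x)) (fun l x => sigma R l.1 x) (n + m)
      (fun k => if k < n then Finset.univ else Finset.univ.filter fun l : ↥L => l.1 ∈ K) x =
      (transfer R B L)^[n] ((transfer R B K)^[m] (fun _ => 1)) x := by
  induction n generalizing x with
  | zero => simp only [zero_add, not_lt_zero, if_false]; exact boxWeight_const K hK m x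
  | succ n ih =>
    rw [Nat.add_right_comm, boxWeight, Function.iterate_succ_apply', transfer]
    simp only [Nat.succ_pos, if_true, Nat.succ_lt_succ_iff, ih]
    exact Finset.sum_coe_sort L (fun l => W B (sigma R l x) *
      (transfer R B L)^[n] ((transfer R B K)^[m] fun _ => 1) (sigma R l x))

/-- The probability of the words whose letters lie in `K` from some position on. -/
lemma pathMeasure_eventually (h : IsHadamardTriple R B L) {K : Finset (ι → ℤ)} (hK : K ⊆ L)
    {H : (ι → ℝ) → ℝ}
    (hH : ∀ x, Tendsto (fun m => (transfer R B K)^[m] (fun _ => 1) x) atTop (𝓝 (H x)))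
    (n : ℕ) (x : ι → ℝ) :
    pathMeasure R B L x {ω | ∀ k, n ≤ k → (ω k).1 ∈ K} =
      ENNReal.ofReal ((transfer R B L)^[n] H x) := by
  have := (isPathMeasure_pathMeasure h x).prob
  set A : ℕ → Finset ↥L :=
    fun k => if k < n then Finset.univ else Finset.univ.filter fun l : ↥L => l.1 ∈ K with hA
  -- The event is a decreasing intersection of finite boxes, so its probability is the limit of
  -- theirs.
  have hset : {ω : ℕ → ↥L | ∀ k, n ≤ k → (ω k).1 ∈ K} = ⋂ m, {ω | ∀ k < n + m, ω k ∈ A k} := by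
    ext ω
    simp only [Set.mem_ofPred_eq, Set.mem_iInter]
    constructor
    · intro hω m k _
      by_cases hkn : k < n
      · simp [hA, hkn]
      · simpa [hA, hkn] using hω k (not_lt.1 hkn)
    · intro hω k hk
      have := hω (k + 1) k (by omega)
      simpa [hA, not_lt.2 hk] using this
  have hmeas : ∀ m, MeasurableSet {ω : ℕ → ↥L | ∀ k < n + m, ω k ∈ A k} := by
    intro m
    have : {ω : ℕ → ↥L | ∀ k < n + m, ω k ∈ A k} =
        ⋂ k ∈ Finset.range (n + m), (fun ω : ℕ → ↥L => ω k) ⁻¹' (A k : Set ↥L) := by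
      ext ω; simp
    rw [this]
    exact Finset.measurableSet_biInter _ fun k _ =>
      (A k).measurableSet.preimage (measurable_pi_apply k)
  have hanti : Antitone fun m => {ω : ℕ → ↥L | ∀ k < n + m, ω k ∈ A k} :=
    fun m m' hmm ω hω k hk => hω k (by omega)
  have h1 := tendsto_measure_iInter_atTop (μ := pathMeasure R B L x)
    (fun m => (hmeas m).nullMeasurableSet) hanti ⟨0, measure_ne_top _ _⟩
  rw [← hset] at h1
  refine tendsto_nhds_unique h1 ?_
  have h2 : ∀ m, pathMeasure R B L x {ω | ∀ k < n + m, ω k ∈ A k} =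
      ENNReal.ofReal ((transfer R B L)^[n] ((transfer R B K)^[m] fun _ => 1) x) := fun m => by
    rw [pathMeasure_box h, hA, boxWeight_eq_transfer K hK]
  simp only [Function.comp_def, h2]
  exact (ENNReal.continuous_ofReal.tendsto _).comp (tendsto_transfer_iterate hH n x)

end Transfer

/-! ### The spectrum of the plane -/

section SpectrumSet

variable {r s : ℕ} {R : Matrix (Fin r ⊕ Fin s) (Fin r ⊕ Fin s) ℤ}
  {B L : Finset (Fin r ⊕ Fin s → ℤ)} {Lam : Set (Fin r → ℝ)}

/-- The letters of `L` that lie in the plane. -/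
def planeLetters (L : Finset (Fin r ⊕ Fin s → ℤ)) : Finset (Fin r ⊕ Fin s → ℤ) :=
  L.filter fun l => ∀ j : Fin s, l (Sum.inr j) = 0

lemma planeLetters_subset : planeLetters L ⊆ L := Finset.filter_subset _ _

lemma realVec_mem_plane_of_mem {l : Fin r ⊕ Fin s → ℤ} (hl : l ∈ planeLetters L) :
    realVec l ∈ plane r s := fun j => by
  simp [realVec, (Finset.mem_filter.1 hl).2 j]

lemma mem_planeLetters {l : Fin r ⊕ Fin s → ℤ} :
    l ∈ planeLetters L ↔ ∃ l₁ ∈ sliceL L, inclInt s l₁ = l := by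
  constructor
  · intro hl
    have h1 := eq_inclInt_of_mem_plane (realVec_mem_plane_of_mem hl)
    refine ⟨fstVec l, mem_sliceL.2 ?_, h1.symm⟩
    rw [← h1]; exact planeLetters_subset hl
  · rintro ⟨l₁, hl₁, rfl⟩
    exact Finset.mem_filter.2 ⟨mem_sliceL.1 hl₁, fun _ => rfl⟩

/-- The map `(l, p) ↦ l + S p`. -/
def shiftMap (R : Matrix ι ι ℤ) (p : (ι → ℤ) × (ι → ℝ)) : ι → ℝ :=
  realVec p.1 + realMat Rᵀ *ᵥ p.2

/-- The set `L + S L + ⋯ + S^{n-1} L + S^n (Lam × {0})`. -/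
def spectrumLevel (R : Matrix (Fin r ⊕ Fin s) (Fin r ⊕ Fin s) ℤ)
    (L : Finset (Fin r ⊕ Fin s → ℤ)) (Lam : Set (Fin r → ℝ)) : ℕ → Set (Fin r ⊕ Fin s → ℝ)
  | 0 => incl s '' Lam
  | n + 1 => shiftMap R '' ((L : Set (Fin r ⊕ Fin s → ℤ)) ×ˢ spectrumLevel R L Lam n)

lemma mem_spectrumLevel_iff (n : ℕ) (v : Fin r ⊕ Fin s → ℝ) :
    v ∈ spectrumLevel R L Lam n ↔ ∃ l : Fin n → ↥L, ∃ lam ∈ Lam,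
      v = ∑ k : Fin n, (realMat Rᵀ ^ (k : ℕ)) *ᵥ realVec (l k).1
        + (realMat Rᵀ ^ n) *ᵥ Sum.elim lam (fun _ => 0) := by
  have hshift : ∀ (n : ℕ) (l : Fin n → ↥L) (w : Fin r ⊕ Fin s → ℝ),
      realMat Rᵀ *ᵥ (∑ k : Fin n, (realMat Rᵀ ^ (k : ℕ)) *ᵥ realVec (l k).1 +
        (realMat Rᵀ ^ n) *ᵥ w) =
      ∑ k : Fin n, (realMat Rᵀ ^ ((k : ℕ) + 1)) *ᵥ realVec (l k).1 +
        (realMat Rᵀ ^ (n + 1)) *ᵥ w := by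
    intro n l w
    simp only [mulVec_add, mulVec_sum, mulVec_mulVec, ← pow_succ']
  induction n generalizing v with
  | zero =>
    simp only [spectrumLevel, Set.mem_image, Finset.univ_eq_empty, Finset.sum_empty, pow_zero,
      one_mulVec, zero_add]
    constructor
    · rintro ⟨lam, hlam, rfl⟩
      exact ⟨Fin.elim0, lam, hlam, rfl⟩
    · rintro ⟨-, lam, hlam, rfl⟩
      exact ⟨lam, hlam, rfl⟩
  | succ n ih =>
    constructor
    · rintro ⟨⟨l₀, p⟩, ⟨hl₀, hp⟩, rfl⟩
      obtain ⟨l, lam, hlam, rfl⟩ := (ih p).1 hp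
      refine ⟨Fin.cons ⟨l₀, hl₀⟩ l, lam, hlam, ?_⟩
      simp only [shiftMap, hshift, Fin.sum_univ_succ, Fin.cons_zero, Fin.cons_succ, Fin.val_zero,
        Fin.val_succ, pow_zero, one_mulVec, add_assoc]
    · rintro ⟨l, lam, hlam, rfl⟩
      refine ⟨⟨(l 0).1, _⟩, ⟨(l 0).2, (ih _).2 ⟨Fin.tail l, lam, hlam, rfl⟩⟩, ?_⟩
      simp only [shiftMap, hshift, Fin.sum_univ_succ, Fin.tail, Fin.val_zero,
        Fin.val_succ, pow_zero, one_mulVec, add_assoc]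

lemma spectrumSet_eq_iUnion : spectrumSet R L Lam = ⋃ n, spectrumLevel R L Lam n := by
  ext v
  simp only [Set.mem_iUnion, mem_spectrumLevel_iff]
  rfl

lemma IsLowerBlock.shiftMap_incl (hb : IsLowerBlock R) (l : Fin r → ℤ) (x : Fin r → ℝ) :
    shiftMap R (inclInt s l, incl s x) =
      incl s (realVec l + realMat (blockA R)ᵀ *ᵥ x) := by
  rw [shiftMap, ← incl_realVec, hb.mulVec_incl, ← incl_add]

/-- The inclusion `Λ₁ ⊆ S₁Λ₁ + L₁(0)` puts level `0` inside level `1`; the recursion propagates it.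
-/
lemma spectrumLevel_subset_succ (hb : IsLowerBlock R)
    (hinv : ∀ lam ∈ Lam, ∃ lam' ∈ Lam, ∃ l ∈ sliceL L,
      lam = realMat (blockA R)ᵀ *ᵥ lam' + realVec l) (n : ℕ) :
    spectrumLevel R L Lam n ⊆ spectrumLevel R L Lam (n + 1) := by
  induction n with
  | zero =>
    rintro _ ⟨lam, hlam, rfl⟩
    obtain ⟨lam', hlam', l, hl, rfl⟩ := hinv lam hlam
    refine ⟨(inclInt s l, incl s lam'), ⟨mem_sliceL.1 hl, lam', hlam', rfl⟩, ?_⟩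
    rw [hb.shiftMap_incl, add_comm]
  | succ n ih => exact Set.image_mono (Set.prod_mono subset_rfl ih)

/-- All the images `Sⁿ p` are common periods of the characters `e_b`, `b ∈ B`. -/
def IsStablePeriod (R : Matrix ι ι ℤ) (B : Finset (ι → ℤ)) (p : ι → ℝ) : Prop :=
  ∀ n : ℕ, IsCharPeriod B (realMat Rᵀ ^ n *ᵥ p)

lemma IsStablePeriod.isCharPeriod {R : Matrix ι ι ℤ} {B : Finset (ι → ℤ)} {p : ι → ℝ}
    (hp : IsStablePeriod R B p) : IsCharPeriod B p := by simpa using hp 0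

/-- Powers of `S` keep `l` integral, and integral vectors are periods of every `e_b`. -/
lemma IsStablePeriod.shiftMap {R : Matrix ι ι ℤ} {B : Finset (ι → ℤ)} {p : ι → ℝ}
    (hp : IsStablePeriod R B p) (l : ι → ℤ) : IsStablePeriod R B (shiftMap R (l, p)) := by
  intro n
  have hl : ∀ n : ℕ, realMat Rᵀ ^ n *ᵥ realVec l = realVec (Rᵀ ^ n *ᵥ l) := by
    intro n
    induction n with
    | zero => simp
    | succ n ih =>
      rw [pow_succ', ← mulVec_mulVec, ih, ← realVec_mulVec, mulVec_mulVec, ← pow_succ']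
  rw [AffineIFS.shiftMap, mulVec_add, hl, mulVec_mulVec, ← pow_succ]
  exact (isCharPeriod_realVec B _).add (hp (n + 1))

/-- Periodicity of the modulus, tested at the origin where `W₁ = 1`, forces maximal modulus at
`S₁ⁿλ`, and hence periodicity of every character. -/
lemma isCharPeriod_of_isPeriod (h0 : (0 : Fin r ⊕ Fin s → ℤ) ∈ B) {lam : Fin r → ℝ}
    (hper : IsPeriod (blockA R)ᵀ (W₁ B) lam) (n : ℕ) :
    IsCharPeriod (projB B) (realMat (blockA R)ᵀ ^ n *ᵥ lam) := by
  refine isCharPeriod_of_norm_mask_eq_one (zero_mem_projB h0) ?_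
  have h := hper n 0
  rw [zero_add] at h
  rw [← W₁, h, W₁, mask_zero ⟨_, zero_mem_projB h0⟩, norm_one]

lemma isStablePeriod_incl (hb : IsLowerBlock R) (h0 : (0 : Fin r ⊕ Fin s → ℤ) ∈ B)
    {lam : Fin r → ℝ} (hper : IsPeriod (blockA R)ᵀ (W₁ B) lam) :
    IsStablePeriod R B (incl s lam) := by
  intro n b hbB
  rw [hb.pow_mulVec_incl, expo_incl, proj_realVec]
  exact isCharPeriod_of_isPeriod h0 hper n _ (Finset.mem_image_of_mem _ hbB)

lemma isStablePeriod_of_mem_spectrumLevel (hb : IsLowerBlock R)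
    (h0 : (0 : Fin r ⊕ Fin s → ℤ) ∈ B)
    (hper : ∀ lam ∈ Lam, IsPeriod (blockA R)ᵀ (W₁ B) lam) (n : ℕ) :
    ∀ p ∈ spectrumLevel R L Lam n, IsStablePeriod R B p := by
  induction n with
  | zero =>
    rintro _ ⟨lam, hlam, rfl⟩
    exact isStablePeriod_incl hb h0 (hper lam hlam)
  | succ n ih =>
    rintro _ ⟨⟨l, p⟩, ⟨-, hp⟩, rfl⟩
    exact (ih p hp).shiftMap l

lemma invariantMeasure_block_eq_map (h : IsHadamardTriple R B L)
    (hF : IsInvariantSet R B L (plane r s)) :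
    invariantMeasure (blockA R) (projB B) = (invariantMeasure R B).map proj := by
  have h1 := isHadamardTriple_block h hF
  have hμ := isInvariantMeasure_invariantMeasure h.expanding ⟨_, h.zero_mem_B⟩
  exact (isInvariantMeasure_invariantMeasure h1.expanding ⟨_, h1.zero_mem_B⟩).unique h1.expanding
    (isInvariantMeasure_map_proj h hF hμ)

/-- The map `(l, λ) ↦ l + S₁ λ` maps `L₁ × Λ₁` into `Λ₁`: its values are pairwise orthogonal
frequencies. -/
lemma add_mulVec_mem_of_isSpectrum {A : Matrix ι ι ℤ} {D K : Finset (ι → ℤ)}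
    (h : IsHadamardTriple A D K) {ν : Measure (ι → ℝ)} (hν : IsInvariantMeasure A D ν)
    {Lam : Set (ι → ℝ)} (hsp : IsSpectrum ν Lam)
    (hinv : ∀ lam ∈ Lam, ∃ lam' ∈ Lam, ∃ l ∈ K, lam = realMat Aᵀ *ᵥ lam' + realVec l)
    (hper : ∀ lam ∈ Lam, IsCharPeriod D lam) {l : ι → ℤ} (hl : l ∈ K) {lam : ι → ℝ}
    (hlam : lam ∈ Lam) : realVec l + realMat Aᵀ *ᵥ lam ∈ Lam := by
  have := hν.prob
  by_contra hnot
  -- Were the value outside `Λ₁`, completeness would give some `κ ∈ Λ₁` not orthogonal to it.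
  -- Writing `κ = S₁λ' + l'` contradicts this: for `l = l'` by orthogonality within `Λ₁`, for `l ≠
  -- l'` by the Hadamard condition.
  obtain ⟨κ, hκ, hne⟩ := hsp.exists_fourier_ne_zero (realVec l + realMat Aᵀ *ᵥ lam)
  obtain ⟨lam', hlam', l', hl', rfl⟩ := hinv κ hκ
  refine hne ?_
  have h1 : (realMat Aᵀ)⁻¹ *ᵥ (realVec l + realMat Aᵀ *ᵥ lam -
      (realMat Aᵀ *ᵥ lam' + realVec l')) =
      (realMat Aᵀ)⁻¹ *ᵥ (realVec l - realVec l') + (lam - lam') := by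
    rw [show realVec l + realMat Aᵀ *ᵥ lam - (realMat Aᵀ *ᵥ lam' + realVec l') =
      (realVec l - realVec l') + realMat Aᵀ *ᵥ (lam - lam') by rw [mulVec_sub]; abel,
      mulVec_add, inv_mulVec_mulVec h.expanding]
  rw [hν.fourier_eq, h1, ((hper lam hlam).sub (hper lam' hlam')).mask_add]
  by_cases hll : l = l'
  · subst hll
    have hne' : lam ≠ lam' := by
      rintro rfl
      exact hnot (by rwa [add_comm])
    rw [sub_self, mulVec_zero, zero_add, hsp.fourier_sub_eq_zero hlam hlam' hne', mul_zero]
  · rw [hadamard_mask_eq_zero h hl hl' hll, zero_mul]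

/-- The function `x ↦ ∑_{λ ∈ Λ₁} |μ̂(x + (λ, 0))|²`. -/
def planeSum (R : Matrix (Fin r ⊕ Fin s) (Fin r ⊕ Fin s) ℤ)
    (B : Finset (Fin r ⊕ Fin s → ℤ)) (Lam : Set (Fin r → ℝ)) (x : Fin r ⊕ Fin s → ℝ) : ℝ :=
  ∑' p : ↥(incl s '' Lam), ‖fourier (invariantMeasure R B) (x + p.1)‖ ^ 2

lemma planeSum_spec
    (h : IsHadamardTriple R B L) (hF : IsInvariantSet R B L (plane r s))
    (hsp : IsSpectrum (invariantMeasure (blockA R) (projB B)) Lam)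
    (x : Fin r ⊕ Fin s → ℝ) :
    HasSum (fun p : ↥(incl s '' Lam) => ‖fourier (invariantMeasure R B) (x + p.1)‖ ^ 2)
      (planeSum R B Lam x) ∧
    ‖fourier (invariantMeasure R B) (x - incl s (proj x))‖ ^ 2 ≤ planeSum R B Lam x ∧
    planeSum R B Lam x ≤ 1 := by
  have hμ := isInvariantMeasure_invariantMeasure h.expanding ⟨_, h.zero_mem_B⟩
  have := hμ.prob
  rw [invariantMeasure_block_eq_map h hF] at hsp
  obtain ⟨H, hH, h1, h2⟩ := hsp.exists_hasSum_fourier_sq x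
  have : planeSum R B Lam x = H := hH.tsum_eq
  rw [this]
  exact ⟨hH, h1, h2⟩

lemma bijOn_shiftMap_plane
    (h : IsHadamardTriple R B L) (hF : IsInvariantSet R B L (plane r s))
    (hsp : IsSpectrum (invariantMeasure (blockA R) (projB B)) Lam)
    (hinv : ∀ lam ∈ Lam, ∃ lam' ∈ Lam, ∃ l ∈ sliceL L,
      lam = realMat (blockA R)ᵀ *ᵥ lam' + realVec l)
    (hper : ∀ lam ∈ Lam, IsPeriod (blockA R)ᵀ (W₁ B) lam) :
    Set.BijOn (shiftMap R) ((planeLetters L : Set (Fin r ⊕ Fin s → ℤ)) ×ˢ (incl s '' Lam))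
      (incl s '' Lam) := by
  have hb := isLowerBlock_of_isInvariantSet h hF
  have h1 := isHadamardTriple_block h hF
  have hper1 : ∀ lam ∈ Lam, IsCharPeriod (projB B) lam := fun lam hlam => by
    simpa using isCharPeriod_of_isPeriod (R := R) h.zero_mem_B (hper lam hlam) 0
  refine ⟨?_, ?_, ?_⟩
  · rintro ⟨l, _⟩ ⟨hl, lam, hlam, rfl⟩
    obtain ⟨l₁, hl₁, rfl⟩ := mem_planeLetters.1 hl
    rw [hb.shiftMap_incl]
    exact ⟨_, add_mulVec_mem_of_isSpectrum h1
      (isInvariantMeasure_invariantMeasure h1.expanding ⟨_, h1.zero_mem_B⟩) hsp hinv hper1 hl₁ hlam,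
      rfl⟩
  · refine (injOn_add_mulVec h (Γ := incl s '' Lam) ?_).mono
      (Set.prod_mono (by exact_mod_cast planeLetters_subset) subset_rfl)
    rintro _ ⟨lam, hlam, rfl⟩
    exact (isStablePeriod_incl hb h.zero_mem_B (hper lam hlam)).isCharPeriod
  · rintro _ ⟨lam, hlam, rfl⟩
    obtain ⟨lam', hlam', l, hl, rfl⟩ := hinv lam hlam
    refine ⟨(inclInt s l, incl s lam'), ⟨mem_planeLetters.2 ⟨l, hl, rfl⟩, lam', hlam', rfl⟩, ?_⟩
    rw [hb.shiftMap_incl, add_comm]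

/-- Transferring over the plane letters only permutes the frequencies `Λ₁ × {0}`. -/
lemma planeSum_eq_transfer
    (h : IsHadamardTriple R B L) (hF : IsInvariantSet R B L (plane r s))
    (hsp : IsSpectrum (invariantMeasure (blockA R) (projB B)) Lam)
    (hinv : ∀ lam ∈ Lam, ∃ lam' ∈ Lam, ∃ l ∈ sliceL L,
      lam = realMat (blockA R)ᵀ *ᵥ lam' + realVec l)
    (hper : ∀ lam ∈ Lam, IsPeriod (blockA R)ᵀ (W₁ B) lam) :
    planeSum R B Lam = transfer R B (planeLetters L) (planeSum R B Lam) := by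
  have hb := isLowerBlock_of_isInvariantSet h hF
  have hμ := isInvariantMeasure_invariantMeasure h.expanding ⟨_, h.zero_mem_B⟩
  ext x
  refine (planeSum_spec h hF hsp x).1.unique (hasSum_transfer h.expanding hμ ?_
    (bijOn_shiftMap_plane h hF hsp hinv hper) (fun x => (planeSum_spec h hF hsp x).1) x)
  rintro _ ⟨lam, hlam, rfl⟩
  exact (isStablePeriod_incl hb h.zero_mem_B (hper lam hlam)).isCharPeriod

lemma hasSum_spectrumLevel
    (h : IsHadamardTriple R B L) (hF : IsInvariantSet R B L (plane r s))
    (hsp : IsSpectrum (invariantMeasure (blockA R) (projB B)) Lam)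
    (hper : ∀ lam ∈ Lam, IsPeriod (blockA R)ᵀ (W₁ B) lam)
    (n : ℕ) (x : Fin r ⊕ Fin s → ℝ) :
    HasSum (fun p : ↥(spectrumLevel R L Lam n) =>
      ‖fourier (invariantMeasure R B) (x + p.1)‖ ^ 2)
      ((transfer R B L)^[n] (planeSum R B Lam) x) := by
  have hb := isLowerBlock_of_isInvariantSet h hF
  have hμ := isInvariantMeasure_invariantMeasure h.expanding ⟨_, h.zero_mem_B⟩
  induction n generalizing x with
  | zero => exact (planeSum_spec h hF hsp x).1
  | succ n ih =>
    have hp : ∀ p ∈ spectrumLevel R L Lam n, IsCharPeriod B p := fun p hp =>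
      (isStablePeriod_of_mem_spectrumLevel hb h.zero_mem_B hper n p hp).isCharPeriod
    rw [Function.iterate_succ_apply']
    exact hasSum_transfer h.expanding hμ hp (injOn_add_mulVec h hp).bijOn_image ih x

/-! ### Approach to the plane -/

/-- The component of `x` in `{0} × ℝ^s`. -/
def normalPart (x : Fin r ⊕ Fin s → ℝ) : Fin r ⊕ Fin s → ℝ := x - incl s (proj x)

lemma normalPart_add (x y : Fin r ⊕ Fin s → ℝ) :
    normalPart (x + y) = normalPart x + normalPart y := by
  rw [normalPart, proj_add, incl_add, normalPart, normalPart]; abel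

lemma normalPart_eq_zero {x : Fin r ⊕ Fin s → ℝ} (hx : x ∈ plane r s) : normalPart x = 0 := by
  rw [normalPart, incl_proj hx, sub_self]

lemma continuous_normalPart : Continuous (normalPart (r := r) (s := s)) := by
  refine continuous_id.sub (continuous_pi fun i => ?_)
  cases i with
  | inl i => exact continuous_apply (Sum.inl i)
  | inr j => exact continuous_const

lemma IsLowerBlock.inv_pow_mulVec_mem (hb : IsLowerBlock R) (hR : IsExpanding R) (n : ℕ)
    {x : Fin r ⊕ Fin s → ℝ} (hx : x ∈ plane r s) : (realMat Rᵀ)⁻¹ ^ n *ᵥ x ∈ plane r s := by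
  induction n with
  | zero => simpa using hx
  | succ n ih =>
    rw [pow_succ', ← mulVec_mulVec, ← incl_proj ih, hb.inv_mulVec_incl hR]
    exact incl_mem_plane _

/-- Letters in the plane stay there under `S⁻¹`, so they never affect the normal part. -/
lemma IsLowerBlock.normalPart_sigma (hb : IsLowerBlock R) (hR : IsExpanding R)
    {l : Fin r ⊕ Fin s → ℤ} (hl : l ∈ planeLetters L) (m : ℕ) (x : Fin r ⊕ Fin s → ℝ) :
    normalPart ((realMat Rᵀ)⁻¹ ^ m *ᵥ sigma R l x) =
      normalPart ((realMat Rᵀ)⁻¹ ^ (m + 1) *ᵥ x) := by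
  rw [sigma, mulVec_mulVec, ← pow_succ, mulVec_add, normalPart_add,
    normalPart_eq_zero (hb.inv_pow_mulVec_mem hR _ (realVec_mem_plane_of_mem hl)), add_zero]

lemma tendsto_normalPart_inv_pow (hR : IsExpanding R) (x : Fin r ⊕ Fin s → ℝ) :
    Tendsto (fun m : ℕ => normalPart ((realMat Rᵀ)⁻¹ ^ m *ᵥ x)) atTop (𝓝 0) := by
  have h := (continuous_normalPart.tendsto 0).comp (tendsto_inv_transpose_pow_mulVec hR x)
  have h0 : normalPart (0 : Fin r ⊕ Fin s → ℝ) = 0 := normalPart_eq_zero fun _ => rfl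
  rwa [h0] at h

lemma tendsto_transfer_planeLetters (h : IsHadamardTriple R B L)
    (hF : IsInvariantSet R B L (plane r s))
    (hsp : IsSpectrum (invariantMeasure (blockA R) (projB B)) Lam)
    (hinv : ∀ lam ∈ Lam, ∃ lam' ∈ Lam, ∃ l ∈ sliceL L,
      lam = realMat (blockA R)ᵀ *ᵥ lam' + realVec l)
    (hper : ∀ lam ∈ Lam, IsPeriod (blockA R)ᵀ (W₁ B) lam) (x : Fin r ⊕ Fin s → ℝ) :
    Tendsto (fun m => (transfer R B (planeLetters L))^[m] (fun _ => 1) x) atTop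
      (𝓝 (planeSum R B Lam x)) := by
  have hb := isLowerBlock_of_isInvariantSet h hF
  have hμ := isInvariantMeasure_invariantMeasure h.expanding ⟨_, h.zero_mem_B⟩
  have := hμ.prob
  set T := transfer R B (planeLetters L) with hT
  have hH := planeSum_eq_transfer h hF hsp hinv hper
  -- `h ≤ 1`, `h` is fixed by `T`, and `T` is monotone.
  have hlow : ∀ m x, planeSum R B Lam x ≤ T^[m] (fun _ => 1) x := by
    intro m
    induction m with
    | zero => exact fun x => (planeSum_spec h hF hsp x).2.2
    | succ m ih =>
      intro x
      rw [Function.iterate_succ_apply', hH]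
      exact transfer_mono ih x
  -- The error bound depends on `x` only through its normal part, so at `σ_l x` it is the same for
  -- every plane letter `l`; the weights, of total at most one, can be summed out.
  have hup : ∀ m x, T^[m] (fun _ => 1) x - planeSum R B Lam x ≤
      1 - ‖fourier (invariantMeasure R B) (normalPart ((realMat Rᵀ)⁻¹ ^ m *ᵥ x))‖ ^ 2 := by
    intro m
    induction m with
    | zero =>
      intro x
      have := (planeSum_spec h hF hsp x).2.1
      rw [← normalPart] at this
      simpa only [Function.iterate_zero, id, pow_zero, one_mulVec] using sub_le_sub_left this 1
    | succ m ih =>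
      intro x
      rw [Function.iterate_succ_apply', hH, hT, transfer, transfer, ← Finset.sum_sub_distrib]
      set u := ‖fourier (invariantMeasure R B) (normalPart ((realMat Rᵀ)⁻¹ ^ (m + 1) *ᵥ x))‖ ^ 2
        with hu
      have hu1 : u ≤ 1 := pow_le_one₀ (norm_nonneg _) (norm_fourier_le_one _ _)
      calc ∑ l ∈ planeLetters L, (W B (sigma R l x) * T^[m] (fun _ => 1) (sigma R l x) -
              W B (sigma R l x) * planeSum R B Lam (sigma R l x))
          ≤ ∑ l ∈ planeLetters L, W B (sigma R l x) * (1 - u) := by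
            refine Finset.sum_le_sum fun l hl => ?_
            rw [← mul_sub, hu, ← hb.normalPart_sigma h.expanding hl]
            exact mul_le_mul_of_nonneg_left (ih _) (W_nonneg _ _)
        _ = (∑ l ∈ planeLetters L, W B (sigma R l x)) * (1 - u) := by rw [Finset.sum_mul]
        _ ≤ 1 * (1 - u) := by
            refine mul_le_mul_of_nonneg_right ?_ (by linarith)
            rw [← sum_W_sigma h x]
            exact Finset.sum_le_sum_of_subset_of_nonneg planeLetters_subset
              fun _ _ _ => W_nonneg _ _
        _ = 1 - u := one_mul _
  have hlim : Tendsto (fun m : ℕ =>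
      1 - ‖fourier (invariantMeasure R B) (normalPart ((realMat Rᵀ)⁻¹ ^ m *ᵥ x))‖ ^ 2) atTop
      (𝓝 0) := by
    have h1 := ((continuous_const.sub
      ((continuous_fourier (invariantMeasure R B)).norm.pow 2)).tendsto 0
      (f := fun x => (1 : ℝ) - ‖fourier (invariantMeasure R B) x‖ ^ 2)).comp
      (tendsto_normalPart_inv_pow h.expanding x)
    simpa [fourier_zero, Function.comp_def] using h1
  have h2 : Tendsto (fun m => T^[m] (fun _ => 1) x - planeSum R B Lam x) atTop (𝓝 0) :=
    tendsto_of_tendsto_of_tendsto_of_le_of_le tendsto_const_nhds hlim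
      (fun m => sub_nonneg.2 (hlow m x)) fun m => hup m x
  simpa using h2.add_const (planeSum R B Lam x)

lemma infEDist_plane_le (x : Fin r ⊕ Fin s → ℝ) :
    Metric.infEDist x (plane r s) ≤ ‖normalPart x‖ₑ := by
  refine (Metric.infEDist_le_edist_of_mem (incl_mem_plane (proj x))).trans (le_of_eq ?_)
  rw [edist_eq_enorm_sub, normalPart]

lemma enorm_le_infEDist_plane (x : Fin r ⊕ Fin s → ℝ) (j : Fin s) :
    ‖x (Sum.inr j)‖ₑ ≤ Metric.infEDist x (plane r s) := by
  refine Metric.le_infEDist.2 fun z hz => ?_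
  have h1 := edist_le_pi_edist x z (Sum.inr j)
  rwa [hz j, edist_zero_right] at h1

/-- Each letter is `S x_{n+1} - x_n`. If the path tends to the plane, the normal coordinates of its
letters tend to zero; being integers, they eventually vanish. Conversely, plane letters leave the
normal part to be contracted by powers of `S⁻¹`. -/
lemma IsLowerBlock.wordsTo_plane (hb : IsLowerBlock R) (hR : IsExpanding R) :
    wordsTo R L (plane r s) = ⋃ n, {ω : ℕ → ↥L | ∀ k, n ≤ k → (ω k).1 ∈ planeLetters L} := by
  ext ω
  simp only [wordsTo, Set.mem_ofPred_eq, Set.mem_iUnion]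
  constructor
  · intro hω
    have h0 := hω 0
    have h1 : ∀ j : Fin s, Tendsto (fun n => path R ω 0 n (Sum.inr j)) atTop (𝓝 0) := by
      intro j
      rw [tendsto_zero_iff_enorm_tendsto_zero]
      exact tendsto_of_tendsto_of_tendsto_of_le_of_le tendsto_const_nhds h0
        (fun _ => zero_le) fun n => enorm_le_infEDist_plane _ j
    have h2 : ∀ (n : ℕ) (j : Fin s), ((ω n).1 (Sum.inr j) : ℝ) =
        ∑ k : Fin s, (R (Sum.inr k) (Sum.inr j) : ℝ) * path R ω 0 (n + 1) (Sum.inr k) -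
          path R ω 0 n (Sum.inr j) := by
      intro n j
      have := congrFun (mulVec_sigma hR (ω n).1 (path R ω 0 n)) (Sum.inr j)
      rw [mulVec, dotProduct, Fintype.sum_sum_type] at this
      simp only [realMat, map_apply, transpose_apply, hb.apply, Int.cast_zero, zero_mul,
        Finset.sum_const_zero, zero_add, Pi.add_apply, realVec] at this
      rw [path, this]; ring
    have h3 : ∀ j : Fin s, Tendsto (fun n => ((ω n).1 (Sum.inr j) : ℝ)) atTop (𝓝 0) := by
      intro j
      simp only [h2]
      have := (tendsto_finsetSum Finset.univ fun (k : Fin s) _ =>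
        (((tendsto_add_atTop_iff_nat 1).2 (h1 k)).const_mul
          (R (Sum.inr k) (Sum.inr j) : ℝ))).sub (h1 j)
      simpa using this
    have h4 : ∀ᶠ n in atTop, ∀ j : Fin s, (ω n).1 (Sum.inr j) = 0 := by
      refine eventually_all.2 fun j => ?_
      filter_upwards [(h3 j).eventually (Metric.ball_mem_nhds 0 one_pos)] with n hn
      rw [dist_zero_right, Real.norm_eq_abs] at hn
      have : |(ω n).1 (Sum.inr j)| < 1 := by exact_mod_cast hn
      exact Int.abs_lt_one_iff.1 this
    obtain ⟨n, hn⟩ := eventually_atTop.1 h4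
    exact ⟨n, fun k hk => Finset.mem_filter.2 ⟨(ω k).2, hn k hk⟩⟩
  · rintro ⟨n, hn⟩ x
    -- The extra power `m` is needed for the induction on `k`; only `m = 0` is used afterwards.
    have h1 : ∀ k m : ℕ, normalPart ((realMat Rᵀ)⁻¹ ^ m *ᵥ path R ω x (k + n)) =
        normalPart ((realMat Rᵀ)⁻¹ ^ (m + k) *ᵥ path R ω x n) := by
      intro k
      induction k with
      | zero => simp
      | succ k ih =>
        intro m
        rw [Nat.add_right_comm, path, hb.normalPart_sigma hR (hn _ (by omega)), ih]
        congr 3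
        omega
    rw [← tendsto_add_atTop_iff_nat n]
    have h2 : Tendsto (fun k : ℕ => ‖normalPart ((realMat Rᵀ)⁻¹ ^ k *ᵥ path R ω x n)‖ₑ) atTop
        (𝓝 0) :=
      (tendsto_zero_iff_enorm_tendsto_zero).1 (tendsto_normalPart_inv_pow hR _)
    refine tendsto_of_tendsto_of_tendsto_of_le_of_le tendsto_const_nhds h2
      (fun _ => zero_le) fun k => ?_
    have := h1 k 0
    rw [pow_zero, one_mulVec, zero_add] at this
    simp only [← this]
    exact infEDist_plane_le _

/-- Monotone convergence: a finite set of indices only sees finitely many levels, so one level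
already dominates its partial sum. -/
lemma hasSum_iUnion_of_tendsto {α : Type*} {f : α → ℝ} (hf : ∀ a, 0 ≤ f a) {A : ℕ → Set α}
    (hA : Monotone A) {c : ℕ → ℝ} (hc : ∀ n, HasSum (fun a : ↥(A n) => f a.1) (c n)) {p : ℝ}
    (hp : Tendsto c atTop (𝓝 p)) : HasSum (fun a : ↥(⋃ n, A n) => f a.1) p := by
  have hc' : ∀ n, HasSum ((A n).indicator f) (c n) := fun n => hasSum_subtype_iff_indicator.1 (hc n)
  have hmono : Monotone c := fun m n hmn => hasSum_le
    (fun a => Set.indicator_le_indicator_of_subset (hA hmn) hf a) (hc' m) (hc' n)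
  refine hasSum_subtype_iff_indicator.2 (hasSum_of_isLUB_of_nonneg _
    (fun a => Set.indicator_nonneg (fun _ _ => hf _) a) ⟨?_, fun q hq => ?_⟩)
  · rintro _ ⟨t, rfl⟩
    have hn : ∀ a, ∃ n, (⋃ n, A n).indicator f a = (A n).indicator f a := by
      intro a
      by_cases ha : a ∈ ⋃ n, A n
      · obtain ⟨n, hn⟩ := Set.mem_iUnion.1 ha
        exact ⟨n, by rw [Set.indicator_of_mem ha, Set.indicator_of_mem hn]⟩
      · refine ⟨0, ?_⟩
        rw [Set.indicator_of_notMem ha,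
          Set.indicator_of_notMem fun h => ha (Set.mem_iUnion.2 ⟨0, h⟩)]
    choose n hn using hn
    refine le_trans ?_ (hmono.ge_of_tendsto hp (t.sup n))
    refine le_trans (Finset.sum_le_sum fun a ha => ?_)
      (sum_le_hasSum t (fun a _ => Set.indicator_nonneg (fun _ _ => hf _) a) (hc' (t.sup n)))
    rw [hn a]
    exact Set.indicator_le_indicator_of_subset (hA (Finset.le_sup ha)) hf a
  · refine le_of_tendsto' hp fun n => ?_
    refine le_of_tendsto' (hc' n) fun t => le_trans (Finset.sum_le_sum fun a _ => ?_)
      (hq ⟨t, rfl⟩)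
    exact Set.indicator_le_indicator_of_subset (Set.subset_iUnion A n) hf a

theorem isSpectralSet_plane (h : IsHadamardTriple R B L)
    (hF : IsInvariantSet R B L (plane r s))
    (hsp : IsSpectrum (invariantMeasure (blockA R) (projB B)) Lam)
    (hinv : ∀ lam ∈ Lam, ∃ lam' ∈ Lam, ∃ l ∈ sliceL L,
      lam = realMat (blockA R)ᵀ *ᵥ lam' + realVec l)
    (hper : ∀ lam ∈ Lam, IsPeriod (blockA R)ᵀ (W₁ B) lam) :
    IsSpectralSet R B L (plane r s) (spectrumSet R L Lam) := by
  refine ⟨hF, fun x => ?_⟩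
  have hb := isLowerBlock_of_isInvariantSet h hF
  have := (isPathMeasure_pathMeasure h x).prob
  rw [spectrumSet_eq_iUnion, hb.wordsTo_plane h.expanding]
  refine hasSum_iUnion_of_tendsto
    (f := fun p => ‖fourier (invariantMeasure R B) (x + p)‖ ^ 2) (fun _ => sq_nonneg _)
    (monotone_nat_of_le_succ (spectrumLevel_subset_succ hb hinv))
    (fun n => hasSum_spectrumLevel h hF hsp hper n x) ?_
  have hmono : Monotone fun n => {ω : ℕ → ↥L | ∀ k, n ≤ k → (ω k).1 ∈ planeLetters L} :=
    fun m n hmn ω hω k hk => hω k (hmn.trans hk)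
  -- Continuity from below: at every `n` the probability and the sum over the level are the same
  -- iterate of the transfer operator, so their limits agree.
  have h1 := tendsto_measure_iUnion_atTop (μ := pathMeasure R B L x) hmono
  have h2 := (ENNReal.tendsto_toReal (measure_ne_top _ _)).comp h1
  refine h2.congr fun n => ?_
  rw [Function.comp_apply, Function.comp_apply, pathMeasure_eventually h planeLetters_subset
    (tendsto_transfer_planeLetters h hF hsp hinv hper), ENNReal.toReal_ofReal]
  exact (hasSum_spectrumLevel h hF hsp hper n x).nonneg fun _ => sq_nonneg _

end SpectrumSet

end AffineIFS

end

theorem mainTheorem2 (r s : ℕ) (R : Matrix (Fin r ⊕ Fin s) (Fin r ⊕ Fin s) ℤ)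
    (B L : Finset (Fin r ⊕ Fin s → ℤ)) (hRBL : AffineIFS.IsHadamardTriple R B L)
    (hF : AffineIFS.IsInvariantSet R B L (AffineIFS.plane r s)) :
    (∀ v ∈ AffineIFS.plane r s, AffineIFS.realMat Rᵀ *ᵥ v ∈ AffineIFS.plane r s) ∧
    ∀ Lam₁ : Set (Fin r → ℝ),
      AffineIFS.NoOverlap (AffineIFS.blockA R) (AffineIFS.projB B) →
      AffineIFS.IsSpectrum
        (AffineIFS.invariantMeasure (AffineIFS.blockA R) (AffineIFS.projB B)) Lam₁ →
      (∀ lam ∈ Lam₁, ∃ lam' ∈ Lam₁, ∃ l ∈ AffineIFS.sliceL L,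
        lam = AffineIFS.realMat (AffineIFS.blockA R)ᵀ *ᵥ lam' + AffineIFS.realVec l) →
      (∀ lam ∈ Lam₁, AffineIFS.IsPeriod (AffineIFS.blockA R)ᵀ (AffineIFS.W₁ B) lam) →
      (∃ N₂ : ℕ, (∀ a ∈ AffineIFS.projB B, AffineIFS.fibreCard B a = N₂) ∧
        (AffineIFS.projB B).card * N₂ = B.card) ∧
      AffineIFS.IsHadamardTriple (AffineIFS.blockA R) (AffineIFS.projB B)
        (AffineIFS.sliceL L) ∧
      AffineIFS.IsSpectralSet R B L (AffineIFS.plane r s)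
        (AffineIFS.spectrumSet R L Lam₁) := by
  refine ⟨AffineIFS.plane_mulVec_mem hRBL hF, fun Lam₁ _ hsp hinv hper => ?_⟩
  exact ⟨AffineIFS.exists_fibreCard_eq hRBL hF, AffineIFS.isHadamardTriple_block hRBL hF,
    AffineIFS.isSpectralSet_plane hRBL hF hsp hinv hper⟩
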